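/- Let $L$ be an even positive integer, $\Lambda=(\mathbb Z/L\mathbb Z)^2$, $\mathcal S=\{-1,+1\}^\Lambda$, $0<h<1$, $\lambda=\lfloor 2/h\rfloor+1$, $\Gamma_{\mathrm m}=-2h\lambda^2+2(4+h)\lambda-2h$, and assume $L>2\lambda$. For $\beta>0$ and $\sigma\in\mathcal S$ let $S_\sigma(x)$ be the sum of $\sigma$ over the four nearest neighbours of $x$, let $$p(\sigma,\eta)=\prod_{x\in\Lambda}\frac1{1+e^{-2\beta\eta(x)(S_\sigma(x)+h)}},\qquad H(\sigma)=-h\sum_{x}\sigma(x)-\frac1\beta\sum_{x}\log\cosh[\beta(S_\sigma(x)+h)],$$ and let $\mu(\sigma)=e^{-\beta H(\sigma)}/\sum_{\eta}e^{-\beta H(\eta)}$ be the Gibbs measure. For disjoint non-empty $A,B\subset\mathcal S$ put $$\mathrm{cap}_\beta(A,B)=\min\Big\{\tfrac12\sum_{\sigma,\eta\in\mathcal S}\mu(\sigma)p(\sigma,\eta)[f(\sigma)-f(\eta)]^2\;:\;f:\mathcal S\to[0,1],\ f|_A=1,\ f|_B=0\Big\}.$$ Let $\mathbf d\equiv-1$,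 $\mathbf u\equiv+1$, $\mathbf c^{\mathrm e}(x)=(-1)^{x_1+x_2}$, $\mathbf c^{\mathrm o}=-\mathbf c^{\mathrm e}$, $\mathbf c=\{\mathbf c^{\mathrm e},\mathbf c^{\mathrm o}\}$ and $\mu(\mathbf c)=\mu(\mathbf c^{\mathrm e})+\mu(\mathbf c^{\mathrm o})$. Then there are constants $0<k_1,k_2<\infty$, not depending on $\beta$, such that, as $\beta\to\infty$, $$\frac{\mu(\mathbf d)}{\mathrm{cap}_\beta(\mathbf d,\{\mathbf c,\mathbf u\})}=\frac{e^{\beta\Gamma_{\mathrm m}}}{k_2}[1+o(1)]\qquad\text{and}\qquad\frac{\mu(\mathbf c)}{\mathrm{cap}_\beta(\mathbf c,\mathbf u)}=\frac{e^{\beta\Gamma_{\mathrm m}}}{k_1}[1+o(1)].$$ If moreover $2/h$ is not an integer, then $k_2=4\lambda L^2$, the number of ways to place a $\lambda\times(\lambda-1)$ rectangle on the torus (in either orientation), fill it with one of the two checkerboards, and attach a protuberance to one of its longer sides next to a plus spin; and $k_1=2\lambda L^2$. -/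

import Mathlib

noncomputable section

namespace PCA

/-- The two-dimensional torus of side length `L`. -/
abbrev Torus (L : ℕ) : Type := ZMod L × ZMod L

/-- Spin configurations: every site carries a spin `-1` or `+1`. -/
abbrev Config (L : ℕ) : Type := Torus L → ℤˣ

/-- The real value of a spin. -/
def spin (s : ℤˣ) : ℝ := ((s : ℤ) : ℝ)

/-- The interaction kernel: `1` for a displacement of length one on the torus, `0` otherwise. -/
def kernel {L : ℕ} (z : Torus L) : ℝ :=
  if z = (1, 0) ∨ z = (-1, 0) ∨ z = (0, 1) ∨ z = (0, -1) then 1 else 0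

/-- `S_σ(x) = ∑_y K(x - y) σ(y)`. -/
def localField {L : ℕ} [NeZero L] (σ : Config L) (x : Torus L) : ℝ :=
  ∑ y : Torus L, kernel (x - y) * spin (σ y)

/-- `p_{x,σ}(s)`, the probability that the spin at `x` is updated to `s`. -/
def siteProb {L : ℕ} [NeZero L] (β h : ℝ) (σ : Config L) (x : Torus L) (s : ℤˣ) : ℝ :=
  1 / (1 + Real.exp (-2 * β * spin s * (localField σ x + h)))

/-- The transition matrix of the chain: all the spins are updated simultaneously and
independently. -/
def transProb {L : ℕ} [NeZero L] (β h : ℝ) (σ η : Config L) : ℝ :=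
  ∏ x : Torus L, siteProb β h σ x (η x)

/-- The Hamiltonian `H`, which depends on `β`. -/
def hamiltonian {L : ℕ} [NeZero L] (β h : ℝ) (σ : Config L) : ℝ :=
  -h * ∑ x : Torus L, spin (σ x)
    - (1 / β) * ∑ x : Torus L, Real.log (Real.cosh (β * (localField σ x + h)))

/-- The partition function `Z`. -/
def partitionFun (L : ℕ) [NeZero L] (β h : ℝ) : ℝ :=
  ∑ η : Config L, Real.exp (-β * hamiltonian β h η)

/-- The Gibbs weight `μ(σ)` of a configuration. -/
def gibbs {L : ℕ} [NeZero L] (β h : ℝ) (σ : Config L) : ℝ :=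
  Real.exp (-β * hamiltonian β h σ) / partitionFun L β h

/-- The Gibbs measure `μ(A)` of a finite set of configurations. -/
def gibbsSet {L : ℕ} [NeZero L] (β h : ℝ) (A : Finset (Config L)) : ℝ :=
  ∑ σ ∈ A, gibbs β h σ

/-- The Dirichlet form of the reversible chain. -/
def dirichlet {L : ℕ} [NeZero L] (β h : ℝ) (f : Config L → ℝ) : ℝ :=
  (1 / 2) * ∑ σ : Config L, ∑ η : Config L,
    gibbs β h σ * transProb β h σ η * (f σ - f η) ^ 2

/-- The capacity of a pair of (disjoint, non-empty) sets of configurations: the minimum of the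
Dirichlet form over the functions with values in `[0,1]`, equal to `1` on `A` and to `0` on `B`. -/
def capacity {L : ℕ} [NeZero L] (β h : ℝ) (A B : Finset (Config L)) : ℝ :=
  sInf (dirichlet β h ''
    {f : Config L → ℝ | (∀ σ, 0 ≤ f σ ∧ f σ ≤ 1) ∧ (∀ σ ∈ A, f σ = 1) ∧ (∀ σ ∈ B, f σ = 0)})

/-- The configuration `d`: all spins are minus. -/
def allMinus (L : ℕ) : Config L := fun _ => -1

/-- The configuration `u`: all spins are plus. -/
def allPlus (L : ℕ) : Config L := fun _ => 1

/-- The checkerboard `c^e`, with the pluses on the even sublattice. -/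
def checkerEven (L : ℕ) : Config L := fun x => (-1) ^ (x.1.val + x.2.val)

/-- The checkerboard `c^o`, with the pluses on the odd sublattice. -/
def checkerOdd (L : ℕ) : Config L := fun x => (-1) ^ (x.1.val + x.2.val + 1)

open Classical in
/-- The pair `c = {c^e, c^o}`. -/
def checkers (L : ℕ) : Finset (Config L) := {checkerEven L, checkerOdd L}

open Classical in
/-- The set `{c, u} = {c^e, c^o, u}`. -/
def checkersPlus (L : ℕ) : Finset (Config L) := {checkerEven L, checkerOdd L, allPlus L}

/-- The critical length `λ = ⌊2/h⌋ + 1`. -/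
def critLength (h : ℝ) : ℕ := ⌊2 / h⌋₊ + 1

/-- The activation energy `Γ_m = -2hλ² + 2(4+h)λ - 2h`. -/
def activationEnergy (h : ℝ) : ℝ :=
  -2 * h * (critLength h : ℝ) ^ 2 + 2 * (4 + h) * (critLength h : ℝ) - 2 * h

end PCA

end

/-! A site is updated according to its four neighbours only, and `L` is even, so a transition from σ
to η couples the even half of σ with the odd half of η, and the odd half of σ with the even half of
η. Gluing these halves produces two ordinary configurations, `mix σ η` and `mix η σ`. The `cosh`
factors of the Gibbs weight cancel the normalisations of the updates, and `gibbs_mul_transProb`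
shows that μ(σ)p(σ,η) is a common factor times the product of two Ising weights. The chain is thus
an electrical network whose edge energy `pairEnergy` is the sum of the Ising energies `excess` of
two plus sets. The loop at d is the pair (∅, ∅), the loop at u is (full, full), and the edge between
the two checkerboards consists of one empty and one full copy.

Both capacities then describe the nucleation of one Ising copy while the other is a spectator, empty
in the first case and full in the second. Put m = ⌊2/h⌋. By an isoperimetric inequality, a set that
leaves the class `Subcritical` by one added site cannot stay below `critEnergy`, the energy of an m
× (m + 1) quasi-square with a protuberance on a longer side. If 2/h is not an integer, it can leave
at that energy only as such a droplet (`subcritical_insert`). Simultaneous updates open no cheaper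
passage: sites of one sublattice do not interact, so they can be flipped one by one in an
energetically favourable way (`class_stable`). This yields cuts whose edges cost at least the
barrier (`exists_cut_minus`, `exists_cut_plus`); explicit growth of rectangles gives paths that
reach it (`grow_univ`).

After rescaling by the barrier, connection at that level and a cut at that level already force the
capacity to converge to a positive limit (`exists_tendsto_netCap`). If 2/h is not an integer, the
critical edges are exactly those given by the droplets, and each joins the starting cluster directly
to the final one, because the last site of the droplet and the next site to be filled have opposite
parities (`critical_passage`). All these edges are then in parallel with unit conductance, so the
limit is the number 4(m + 1)L² of droplets (`tendsto_netCap`).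

Finally, d is almost surely mapped to itself and each checkerboard to the other as β tends to
infinity, so their Gibbs weights are asymptotic to explicit edge weights. The set c consists of two
configurations of equal asymptotic weight, which halves k₁. -/

noncomputable section

set_option linter.unusedSectionVars false

namespace PCA

/-! ### Low-temperature asymptotics of capacities in a finite network -/

section Network

variable {V : Type*}

/-- Potentials with values in `[0,1]` that are `1` on `A` and `0` on `B`. -/
def potentials (A B : Finset V) : Set (V → ℝ) :=
  {f | (∀ σ, 0 ≤ f σ ∧ f σ ≤ 1) ∧ (∀ σ ∈ A, f σ = 1) ∧ (∀ σ ∈ B, f σ = 0)}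

lemma sq_sub_le_one_of_mem {A B : Finset V} {f : V → ℝ} (hf : f ∈ potentials A B) (σ η : V) :
    (f σ - f η) ^ 2 ≤ 1 := by
  have h1 := hf.1 σ
  have h2 := hf.1 η
  have : |f σ - f η| ≤ 1 := abs_le.2 ⟨by linarith, by linarith⟩
  exact (sq_le_one_iff_abs_le_one _).2 this

variable [Fintype V]

/-- The Dirichlet form of the network with conductances `exp (-β (E σ η - Γ))`. -/
def netForm (E : V → V → ℝ) (Γ β : ℝ) (f : V → ℝ) : ℝ :=
  (1 / 2) * ∑ σ, ∑ η, Real.exp (-β * (E σ η - Γ)) * (f σ - f η) ^ 2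

/-- The part of `netForm` carried by the edges of energy at most `Γ`. -/
def lowForm (E : V → V → ℝ) (Γ β : ℝ) (f : V → ℝ) : ℝ :=
  (1 / 2) * ∑ σ, ∑ η,
    (if E σ η ≤ Γ then Real.exp (-β * (E σ η - Γ)) else 0) * (f σ - f η) ^ 2

/-- The capacity of the network `netForm`. -/
def netCap (E : V → V → ℝ) (Γ : ℝ) (A B : Finset V) (β : ℝ) : ℝ :=
  sInf (netForm E Γ β '' potentials A B)

lemma netForm_nonneg (E : V → V → ℝ) (Γ β : ℝ) (f : V → ℝ) : 0 ≤ netForm E Γ β f := by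
  unfold netForm; positivity

lemma lowForm_nonneg (E : V → V → ℝ) (Γ β : ℝ) (f : V → ℝ) : 0 ≤ lowForm E Γ β f := by
  unfold lowForm
  refine mul_nonneg (by norm_num) (Finset.sum_nonneg fun σ _ => Finset.sum_nonneg fun η _ => ?_)
  split_ifs <;> positivity

lemma edge_le_netForm (E : V → V → ℝ) (Γ β : ℝ) (f : V → ℝ) (σ η : V) :
    Real.exp (-β * (E σ η - Γ)) * (f σ - f η) ^ 2 ≤ 2 * netForm E Γ β f := by
  unfold netForm
  have h1 : Real.exp (-β * (E σ η - Γ)) * (f σ - f η) ^ 2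
      ≤ ∑ η, Real.exp (-β * (E σ η - Γ)) * (f σ - f η) ^ 2 :=
    Finset.single_le_sum (f := fun η => Real.exp (-β * (E σ η - Γ)) * (f σ - f η) ^ 2)
      (fun _ _ => by positivity) (Finset.mem_univ η)
  have h2 : ∑ η, Real.exp (-β * (E σ η - Γ)) * (f σ - f η) ^ 2
      ≤ ∑ σ, ∑ η, Real.exp (-β * (E σ η - Γ)) * (f σ - f η) ^ 2 :=
    Finset.single_le_sum (f := fun σ => ∑ η, Real.exp (-β * (E σ η - Γ)) * (f σ - f η) ^ 2)
      (fun _ _ => by positivity) (Finset.mem_univ σ)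
  linarith

/-- Potential differences inside a cluster of edges of energy at most `Γ - ε` are controlled by
the Dirichlet form. -/
lemma sq_sub_le_of_eqvGen {E : V → V → ℝ} {Γ ε : ℝ} {σ η : V}
    (h : Relation.EqvGen (fun σ η => E σ η ≤ Γ - ε) σ η) :
    ∃ c : ℝ, 0 < c ∧ ∀ β : ℝ, 0 ≤ β → ∀ f : V → ℝ,
      (f σ - f η) ^ 2 ≤ c * Real.exp (-β * ε) * netForm E Γ β f := by
  induction h with
  | rel σ η h =>
    refine ⟨2, by norm_num, fun β hβ f => ?_⟩
    have h1 := edge_le_netForm E Γ β f σ η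
    -- An edge of energy at most Γ - ε has conductance at least exp(βε).
    have h2 : 1 ≤ Real.exp (-β * ε) * Real.exp (-β * (E σ η - Γ)) := by
      rw [← Real.exp_add]
      exact Real.one_le_exp (by nlinarith)
    have h3 : (f σ - f η) ^ 2 ≤
        Real.exp (-β * ε) * (Real.exp (-β * (E σ η - Γ)) * (f σ - f η) ^ 2) := by
      rw [← mul_assoc]; exact le_mul_of_one_le_left (sq_nonneg _) h2
    have h4 := mul_le_mul_of_nonneg_left h1 (Real.exp_pos (-β * ε)).le
    linarith
  | refl σ =>
    refine ⟨1, one_pos, fun β _ f => ?_⟩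
    have := netForm_nonneg E Γ β f
    have h0 : (f σ - f σ) ^ 2 = 0 := by ring
    rw [h0]; positivity
  | symm σ η _ ih =>
    obtain ⟨c, hc, H⟩ := ih
    refine ⟨c, hc, fun β hβ f => ?_⟩
    have := H β hβ f
    rwa [← neg_sub, neg_sq] at this
  | trans σ τ η _ _ ih1 ih2 =>
    obtain ⟨c, hc, H⟩ := ih1
    obtain ⟨c', hc', H'⟩ := ih2
    -- From (x + y)² ≤ 2x² + 2y².
    refine ⟨2 * (c + c'), by positivity, fun β hβ f => ?_⟩
    have h1 := H β hβ f
    have h2 := H' β hβ f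
    nlinarith [sq_nonneg ((f σ - f τ) - (f τ - f η))]

lemma netCap_le {E : V → V → ℝ} {Γ β : ℝ} {A B : Finset V} {f : V → ℝ}
    (hf : f ∈ potentials A B) : netCap E Γ A B β ≤ netForm E Γ β f :=
  csInf_le ⟨0, by rintro _ ⟨g, _, rfl⟩; exact netForm_nonneg E Γ β g⟩ ⟨f, hf, rfl⟩

lemma le_netCap {E : V → V → ℝ} {Γ β c : ℝ} {A B : Finset V} (hne : (potentials A B).Nonempty)
    (h : ∀ f ∈ potentials A B, c ≤ netForm E Γ β f) : c ≤ netCap E Γ A B β :=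
  le_csInf (hne.image _) (by rintro _ ⟨g, hg, rfl⟩; exact h g hg)

/-- Finitely many energies above (or below) a level keep a positive distance from it. -/
lemma exists_gap (E : V → V → ℝ) (Γ : ℝ) :
    ∃ ε : ℝ, 0 < ε ∧ (∀ σ η, Γ < E σ η → Γ + ε ≤ E σ η) ∧ (∀ σ η, E σ η < Γ → E σ η ≤ Γ - ε) := by
  classical
  -- The element 1 keeps `S` nonempty when all energies equal Γ.
  let S : Finset ℝ := insert 1 ((Finset.univ.image fun p : V × V => |E p.1 p.2 - Γ|).filter (0 < ·))
  have hS : S.Nonempty := ⟨1, Finset.mem_insert_self _ _⟩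
  have hmem : ∀ σ η, E σ η ≠ Γ → S.min' hS ≤ |E σ η - Γ| := fun σ η hne => by
    refine Finset.min'_le _ _ (Finset.mem_insert_of_mem (Finset.mem_filter.2 ⟨?_, ?_⟩))
    · exact Finset.mem_image.2 ⟨(σ, η), Finset.mem_univ _, rfl⟩
    · exact abs_pos.2 (sub_ne_zero.2 hne)
  refine ⟨S.min' hS, ?_, fun σ η h => ?_, fun σ η h => ?_⟩
  · have := Finset.min'_mem S hS
    rcases Finset.mem_insert.1 this with h | h
    · rw [h]; exact one_pos
    · exact (Finset.mem_filter.1 h).2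
  · have := hmem σ η h.ne'
    rw [abs_of_pos (by linarith)] at this; linarith
  · have := hmem σ η h.ne
    rw [abs_of_neg (by linarith)] at this; linarith

/-- Potential differences are at most one and each edge above Γ has conductance at most exp(-βε), so
these edges are negligible. -/
lemma netForm_le_lowForm_add {E : V → V → ℝ} {Γ ε β : ℝ} (hβ : 0 ≤ β)
    (hε : ∀ σ η, Γ < E σ η → Γ + ε ≤ E σ η) {A B : Finset V} {f : V → ℝ}
    (hf : f ∈ potentials A B) :
    netForm E Γ β f ≤ lowForm E Γ β f + (Fintype.card V : ℝ) ^ 2 * Real.exp (-β * ε) := by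
  have hterm : ∀ σ η, Real.exp (-β * (E σ η - Γ)) * (f σ - f η) ^ 2 ≤
      (if E σ η ≤ Γ then Real.exp (-β * (E σ η - Γ)) else 0) * (f σ - f η) ^ 2
        + Real.exp (-β * ε) := by
    intro σ η
    split_ifs with h
    · linarith [Real.exp_pos (-β * ε)]
    · have h1 := hε σ η (not_le.1 h)
      have h2 : Real.exp (-β * (E σ η - Γ)) ≤ Real.exp (-β * ε) :=
        Real.exp_le_exp.2 (by nlinarith)
      have h3 := sq_sub_le_one_of_mem hf σ η
      nlinarith [Real.exp_pos (-β * (E σ η - Γ)), sq_nonneg (f σ - f η)]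
  have hsum := Finset.sum_le_sum fun σ (_ : σ ∈ Finset.univ) =>
    Finset.sum_le_sum fun η (_ : η ∈ Finset.univ) => hterm σ η
  simp only [Finset.sum_add_distrib, Finset.sum_const, Finset.card_univ, nsmul_eq_mul] at hsum
  have hpos : 0 ≤ (Fintype.card V : ℝ) ^ 2 * Real.exp (-β * ε) := by positivity
  unfold netForm lowForm
  nlinarith

lemma lowForm_le_netForm (E : V → V → ℝ) (Γ β : ℝ) (f : V → ℝ) :
    lowForm E Γ β f ≤ netForm E Γ β f := by
  unfold netForm lowForm
  refine mul_le_mul_of_nonneg_left (Finset.sum_le_sum fun σ _ => Finset.sum_le_sum fun η _ => ?_)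
    (by norm_num)
  refine mul_le_mul_of_nonneg_right ?_ (sq_nonneg _)
  split_ifs
  · exact le_rfl
  · positivity

/-- The conductances of the edges of energy at most Γ do not decrease with β. Monotonicity is what
produces a limit without solving the variational problem. -/
lemma lowForm_mono (E : V → V → ℝ) (Γ : ℝ) (f : V → ℝ) {β β' : ℝ} (hβ : β ≤ β') :
    lowForm E Γ β f ≤ lowForm E Γ β' f := by
  unfold lowForm
  refine mul_le_mul_of_nonneg_left (Finset.sum_le_sum fun σ _ => Finset.sum_le_sum fun η _ => ?_)
    (by norm_num)
  refine mul_le_mul_of_nonneg_right ?_ (sq_nonneg _)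
  split_ifs with h
  · exact Real.exp_le_exp.2 (by nlinarith)
  · exact le_rfl

lemma tendsto_exp_neg_mul {ε : ℝ} (hε : 0 < ε) :
    Filter.Tendsto (fun β : ℝ => Real.exp (-β * ε)) Filter.atTop (nhds 0) := by
  refine Real.tendsto_exp_atBot.comp ?_
  simpa using (Filter.tendsto_neg_atTop_atBot (G := ℝ)).atBot_mul_const hε

/-- If `A` and `B` are connected at level `Γ` but at no lower level, then the rescaled capacity
has a positive limit. -/
theorem exists_tendsto_netCap {E : V → V → ℝ} {Γ : ℝ} {A B : Finset V} {f₀ : V → ℝ}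
    (hf₀ : f₀ ∈ potentials A B) (hcut : ∀ σ η, f₀ σ ≠ f₀ η → Γ ≤ E σ η)
    {a b : V} (ha : a ∈ A) (hb : b ∈ B)
    (hconn : Relation.EqvGen (fun σ η => E σ η ≤ Γ) a b) :
    ∃ k : ℝ, 0 < k ∧ Filter.Tendsto (netCap E Γ A B) Filter.atTop (nhds k) := by
  have hne : (potentials A B).Nonempty := ⟨f₀, hf₀⟩
  -- The infimum of the low form is monotone in β. It is bounded because `f₀` jumps only across
  -- edges of energy at least Γ, so that its low form does not depend on β.
  let m : ℝ → ℝ := fun β => sInf (lowForm E Γ β '' potentials A B)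
  have hbdd : ∀ β, BddBelow (lowForm E Γ β '' potentials A B) := fun β =>
    ⟨0, by rintro _ ⟨g, _, rfl⟩; exact lowForm_nonneg E Γ β g⟩
  have hm_mono : Monotone m := fun β β' hβ => by
    refine le_csInf (hne.image _) ?_
    rintro _ ⟨g, hg, rfl⟩
    exact (csInf_le (hbdd β) ⟨g, hg, rfl⟩).trans (lowForm_mono E Γ g hβ)
  have hm_bdd : BddAbove (Set.range m) := by
    refine ⟨lowForm E Γ 0 f₀, ?_⟩
    rintro _ ⟨β, rfl⟩
    refine (csInf_le (hbdd β) ⟨f₀, hf₀, rfl⟩).trans (le_of_eq ?_)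
    unfold lowForm
    congr 1
    refine Finset.sum_congr rfl fun σ _ => Finset.sum_congr rfl fun η _ => ?_
    by_cases h : f₀ σ = f₀ η
    · simp [h]
    · split_ifs with h'
      · have : E σ η = Γ := le_antisymm h' (hcut σ η h)
        simp [this]
      · rfl
  have hm_lim := tendsto_atTop_ciSup hm_mono hm_bdd
  obtain ⟨ε, hε, hgap, -⟩ := exists_gap E Γ
  have hlow : ∀ β, m β ≤ netCap E Γ A B β := fun β =>
    le_netCap hne fun f hf => (csInf_le (hbdd β) ⟨f, hf, rfl⟩).trans (lowForm_le_netForm E Γ β f)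
  have hupp : ∀ β, 0 ≤ β →
      netCap E Γ A B β ≤ m β + (Fintype.card V : ℝ) ^ 2 * Real.exp (-β * ε) := fun β hβ => by
    rw [← sub_le_iff_le_add]
    refine le_csInf (hne.image _) ?_
    rintro _ ⟨g, hg, rfl⟩
    have := (netCap_le (E := E) (Γ := Γ) (β := β) hg).trans (netForm_le_lowForm_add hβ hgap hg)
    linarith
  have hlim : Filter.Tendsto (netCap E Γ A B) Filter.atTop (nhds (⨆ β, m β)) := by
    refine tendsto_of_tendsto_of_tendsto_of_le_of_le' hm_lim (h := fun β =>
      m β + (Fintype.card V : ℝ) ^ 2 * Real.exp (-β * ε)) ?_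
      (Filter.Eventually.of_forall hlow) ((Filter.eventually_ge_atTop 0).mono hupp)
    simpa using hm_lim.add ((tendsto_exp_neg_mul hε).const_mul ((Fintype.card V : ℝ) ^ 2))
  -- With ε = 0 the path from `a` to `b` bounds the form of every potential below by 1/c, uniformly
  -- in β, so the limit is positive.
  obtain ⟨c, hc, H⟩ := sq_sub_le_of_eqvGen (E := E) (Γ := Γ) (ε := 0) (by simpa using hconn)
  refine ⟨_, ?_, hlim⟩
  refine lt_of_lt_of_le (inv_pos.2 hc) (ge_of_tendsto hlim ?_)
  filter_upwards [Filter.eventually_ge_atTop 0] with β hβ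
  refine le_netCap hne fun f hf => ?_
  have h1 := H β hβ f
  rw [hf.2.1 a ha, hf.2.2 b hb] at h1
  simp only [sub_zero, one_pow, mul_zero, Real.exp_zero, mul_one] at h1
  exact (inv_le_iff_one_le_mul₀' hc).2 h1

/-- If the level-`Γ` edges leaving the cut `f₀` are exactly those of `T`, and each of them joins
the cluster of `A` to that of `B` below level `Γ`, then the rescaled capacity tends to half the
number of these (oriented) edges. -/
theorem tendsto_netCap {E : V → V → ℝ} {Γ : ℝ} {A B : Finset V} {f₀ : V → ℝ}
    (hf₀ : f₀ ∈ potentials A B) (hcut : ∀ σ η, f₀ σ ≠ f₀ η → Γ ≤ E σ η) (T : Finset (V × V))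
    (hT : ∀ σ η, f₀ σ ≠ f₀ η → E σ η = Γ → (σ, η) ∈ T) (hTE : ∀ p ∈ T, E p.1 p.2 = Γ)
    {a b : V} (ha : a ∈ A) (hb : b ∈ B)
    (hconn : ∀ p ∈ T,
      (Relation.EqvGen (fun σ η => E σ η < Γ) a p.1 ∧
        Relation.EqvGen (fun σ η => E σ η < Γ) b p.2) ∨
      (Relation.EqvGen (fun σ η => E σ η < Γ) a p.2 ∧
        Relation.EqvGen (fun σ η => E σ η < Γ) b p.1)) :
    Filter.Tendsto (netCap E Γ A B) Filter.atTop (nhds ((T.card : ℝ) / 2)) := by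
  classical
  have hne : (potentials A B).Nonempty := ⟨f₀, hf₀⟩
  obtain ⟨ε, hε, hgap, hgap'⟩ := exists_gap E Γ
  -- With u the drop across the edge, 1 - u is the drop inside the two clusters, which is controlled
  -- by exp(-βε) times the form. The weighted inequality 1 ≤ (1 + t)u² + (1 + 1/t)(1 - u)² separates
  -- the two.
  have hedge : ∀ p ∈ T, ∃ c : ℝ, 0 < c ∧ ∀ β : ℝ, 0 ≤ β → ∀ f ∈ potentials A B,
      ∀ t : ℝ, 0 < t → 1 ≤ (1 + t) * (f p.1 - f p.2) ^ 2
        + (1 + t⁻¹) * (c * Real.exp (-β * ε) * netForm E Γ β f) := by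
    have key : ∀ x y : V, Relation.EqvGen (fun σ η => E σ η < Γ) a x →
        Relation.EqvGen (fun σ η => E σ η < Γ) b y →
        ∃ c : ℝ, 0 < c ∧ ∀ β : ℝ, 0 ≤ β → ∀ f ∈ potentials A B,
          ∀ t : ℝ, 0 < t → 1 ≤ (1 + t) * (f x - f y) ^ 2
            + (1 + t⁻¹) * (c * Real.exp (-β * ε) * netForm E Γ β f) := by
      intro x y hx hy
      obtain ⟨c, hc, H⟩ := sq_sub_le_of_eqvGen (ε := ε) (hx.mono fun σ η h => hgap' σ η h)
      obtain ⟨c', hc', H'⟩ := sq_sub_le_of_eqvGen (ε := ε) (hy.mono fun σ η h => hgap' σ η h)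
      refine ⟨2 * (c + c'), by positivity, fun β hβ f hf t ht => ?_⟩
      have h1 := H β hβ f
      have h2 := H' β hβ f
      rw [hf.2.1 a ha] at h1
      rw [hf.2.2 b hb] at h2
      set X := Real.exp (-β * ε) * netForm E Γ β f
      have h3 : ((1 - f x) - (0 - f y)) ^ 2 ≤ 2 * (c + c') * X := by
        nlinarith [sq_nonneg ((1 - f x) + (0 - f y))]
      set u := f x - f y
      have h4 : 1 - u = (1 - f x) - (0 - f y) := by simp only [u]; ring
      rw [← h4] at h3
      have h5 : (1 : ℝ) ≤ (1 + t) * u ^ 2 + (1 + t⁻¹) * (1 - u) ^ 2 := by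
        have : (1 + t) * u ^ 2 + (1 + t⁻¹) * (1 - u) ^ 2 - 1
            = t⁻¹ * (t * u - (1 - u)) ^ 2 := by field_simp; ring
        have h6 : 0 ≤ t⁻¹ * (t * u - (1 - u)) ^ 2 := by positivity
        linarith
      have h7 : 0 ≤ 1 + t⁻¹ := by positivity
      have h8 := mul_le_mul_of_nonneg_left h3 h7
      calc (1 : ℝ) ≤ _ := h5
        _ ≤ _ := by rw [mul_assoc (2 * (c + c'))]; linarith
    intro p hp
    rcases hconn p hp with ⟨h1, h2⟩ | ⟨h1, h2⟩
    · exact key _ _ h1 h2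
    · obtain ⟨c, hc, H⟩ := key _ _ h1 h2
      refine ⟨c, hc, fun β hβ f hf t ht => ?_⟩
      have := H β hβ f hf t ht
      rwa [← neg_sub, neg_sq] at this
  choose! c hc H using hedge
  set C : ℝ := ∑ p ∈ T, c p
  have hT_le : ∀ β f, ∑ p ∈ T, (f p.1 - f p.2) ^ 2 ≤ 2 * netForm E Γ β f := by
    intro β f
    have h1 : ∑ p ∈ T, (f p.1 - f p.2) ^ 2
        = ∑ p ∈ T, Real.exp (-β * (E p.1 p.2 - Γ)) * (f p.1 - f p.2) ^ 2 :=
      Finset.sum_congr rfl fun p hp => by simp [hTE p hp]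
    have h2 : ∑ p ∈ T, Real.exp (-β * (E p.1 p.2 - Γ)) * (f p.1 - f p.2) ^ 2
        ≤ ∑ p : V × V, Real.exp (-β * (E p.1 p.2 - Γ)) * (f p.1 - f p.2) ^ 2 :=
      Finset.sum_le_sum_of_subset_of_nonneg (Finset.subset_univ _) fun _ _ _ => by positivity
    rw [h1]
    refine h2.trans (le_of_eq ?_)
    rw [Fintype.sum_prod_type]
    unfold netForm
    ring
  have hC : 0 ≤ C := Finset.sum_nonneg fun p hp => (hc p hp).le
  -- The weight t = exp(-βε/2) makes both t and exp(-βε)/t vanish, so `D` tends to 2.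
  let D : ℝ → ℝ := fun β =>
    2 * (1 + Real.exp (-β * (ε / 2))) + C * (Real.exp (-β * ε) + Real.exp (-β * (ε / 2)))
  have hD : ∀ β, 0 < D β := fun β => by positivity
  have hlow : ∀ β, 0 ≤ β → (T.card : ℝ) / D β ≤ netCap E Γ A B β := by
    intro β hβ
    refine le_netCap hne fun f hf => ?_
    rw [div_le_iff₀ (hD β)]
    have h1 : ∑ p ∈ T, (1 : ℝ) ≤ ∑ p ∈ T, ((1 + Real.exp (-β * (ε / 2))) * (f p.1 - f p.2) ^ 2
        + (1 + (Real.exp (-β * (ε / 2)))⁻¹) * (c p * Real.exp (-β * ε) * netForm E Γ β f)) :=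
      Finset.sum_le_sum fun p hp => H p hp β hβ f hf _ (Real.exp_pos _)
    rw [Finset.sum_add_distrib, ← Finset.mul_sum, ← Finset.mul_sum, ← Finset.sum_mul,
      ← Finset.sum_mul] at h1
    have h2 := hT_le β f
    have h3 : (1 + (Real.exp (-β * (ε / 2)))⁻¹) * Real.exp (-β * ε)
        = Real.exp (-β * ε) + Real.exp (-β * (ε / 2)) := by
      rw [add_mul, one_mul, ← Real.exp_neg, ← Real.exp_add]; congr 2; ring
    have h4 : (0 : ℝ) < 1 + Real.exp (-β * (ε / 2)) := by positivity
    simp only [Finset.sum_const, nsmul_eq_mul, mul_one] at h1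
    calc (T.card : ℝ) ≤ _ := h1
      _ ≤ (1 + Real.exp (-β * (ε / 2))) * (2 * netForm E Γ β f)
          + (1 + (Real.exp (-β * (ε / 2)))⁻¹) * (C * Real.exp (-β * ε) * netForm E Γ β f) := by
        gcongr
      _ = netForm E Γ β f * (2 * (1 + Real.exp (-β * (ε / 2)))
          + C * ((1 + (Real.exp (-β * (ε / 2)))⁻¹) * Real.exp (-β * ε))) := by ring
      _ = _ := by rw [h3]
  have hupp : ∀ β, 0 ≤ β → netCap E Γ A B β
      ≤ (T.card : ℝ) / 2 + (Fintype.card V : ℝ) ^ 2 * Real.exp (-β * ε) := by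
    intro β hβ
    refine (netCap_le hf₀).trans ((netForm_le_lowForm_add hβ hgap hf₀).trans ?_)
    refine add_le_add ?_ le_rfl
    unfold lowForm
    have : ∑ σ, ∑ η, (if E σ η ≤ Γ then Real.exp (-β * (E σ η - Γ)) else 0) * (f₀ σ - f₀ η) ^ 2
        ≤ T.card := by
      rw [← Fintype.sum_prod_type' (f := fun σ η =>
        (if E σ η ≤ Γ then Real.exp (-β * (E σ η - Γ)) else 0) * (f₀ σ - f₀ η) ^ 2)]
      calc _ ≤ ∑ p : V × V, (if p ∈ T then (1 : ℝ) else 0) := by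
            refine Finset.sum_le_sum fun p _ => ?_
            by_cases h : f₀ p.1 = f₀ p.2
            · rw [h]; simp only [sub_self]; split_ifs <;> simp
            · by_cases h' : E p.1 p.2 ≤ Γ
              · have hE := le_antisymm h' (hcut _ _ h)
                rw [if_pos h', if_pos (hT _ _ h hE), hE]
                simpa using sq_sub_le_one_of_mem hf₀ p.1 p.2
              · rw [if_neg h', zero_mul]; split_ifs <;> simp
        _ = T.card := by simp
    linarith
  refine tendsto_of_tendsto_of_tendsto_of_le_of_le' (g := fun β => (T.card : ℝ) / D β)
    (h := fun β => (T.card : ℝ) / 2 + (Fintype.card V : ℝ) ^ 2 * Real.exp (-β * ε)) ?_ ?_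
    ((Filter.eventually_ge_atTop 0).mono hlow) ((Filter.eventually_ge_atTop 0).mono hupp)
  · have e1 := tendsto_exp_neg_mul hε
    have e2 := tendsto_exp_neg_mul (half_pos hε)
    have : Filter.Tendsto D Filter.atTop (nhds 2) := by
      simpa [D] using ((e2.const_add 1).const_mul 2).add ((e1.add e2).const_mul C)
    exact tendsto_const_nhds.div this two_ne_zero
  · simpa using ((tendsto_exp_neg_mul hε).const_mul ((Fintype.card V : ℝ) ^ 2)).const_add
      ((T.card : ℝ) / 2)

end Network

/-! ### Perimeter and excess energy of finite sets on the torus -/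

section Isoperimetry

variable {L : ℕ} [NeZero L]

/-- The number of boundary bonds of a subset of the cycle. -/
def cyc (T : Finset (ZMod L)) : ℕ := (Finset.univ.filter fun y => ¬ (y ∈ T ↔ y + 1 ∈ T)).card

/-- The number of neighbours of `y` in a subset of the cycle. -/
def lineDeg (T : Finset (ZMod L)) (y : ZMod L) : ℕ :=
  (if y + 1 ∈ T then 1 else 0) + (if y - 1 ∈ T then 1 else 0)

/-- The section of `s` over the first coordinate `c`. -/
def col (s : Finset (Torus L)) (c : ZMod L) : Finset (ZMod L) :=
  Finset.univ.filter fun y => (c, y) ∈ s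

/-- The section of `s` over the second coordinate `r`. -/
def row (s : Finset (Torus L)) (r : ZMod L) : Finset (ZMod L) :=
  Finset.univ.filter fun x => (x, r) ∈ s

/-- The number of boundary bonds of a subset of the torus. -/
def perimeter (s : Finset (Torus L)) : ℕ := ∑ c, cyc (col s c) + ∑ r, cyc (row s r)

/-- The number of neighbours of `z` in `s`. -/
def nbrs (s : Finset (Torus L)) (z : Torus L) : ℕ :=
  lineDeg (col s z.1) z.2 + lineDeg (row s z.2) z.1

/-- The Ising energy of the set `s` of pluses, relative to the configuration without pluses. -/
def excess (h : ℝ) (s : Finset (Torus L)) : ℝ := 2 * perimeter s - 2 * h * s.card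

@[simp] lemma mem_col {s : Finset (Torus L)} {c y : ZMod L} : y ∈ col s c ↔ (c, y) ∈ s := by
  simp [col]

@[simp] lemma mem_row {s : Finset (Torus L)} {r x : ZMod L} : x ∈ row s r ↔ (x, r) ∈ s := by
  simp [row]

/-- The bonds inside a subset of the cycle. -/
def innerBonds (T : Finset (ZMod L)) : ℕ := (T.filter fun y => y + 1 ∈ T).card

/-- Each site has two bonds; counting bonds from their ends in `T` sees boundary bonds once and
inner bonds twice. -/
lemma cyc_add_innerBonds (T : Finset (ZMod L)) : cyc T + 2 * innerBonds T = 2 * T.card := by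
  have h1 : T.card = ∑ y : ZMod L, if y ∈ T then 1 else 0 := by simp
  have h2 : T.card = ∑ y : ZMod L, if y + 1 ∈ T then 1 else 0 := by
    rw [h1]
    exact (Equiv.sum_comp (Equiv.addRight (1 : ZMod L)) fun y => if y ∈ T then 1 else 0).symm
  have h3 : innerBonds T = ∑ y : ZMod L, if y ∈ T ∧ y + 1 ∈ T then 1 else 0 := by
    rw [innerBonds, ← Finset.card_filter]
    congr 1; ext y; simp
  have h4 : cyc T = ∑ y : ZMod L, if ¬ (y ∈ T ↔ y + 1 ∈ T) then 1 else 0 := by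
    rw [cyc, Finset.card_filter]
  have h5 : 2 * T.card = ∑ y : ZMod L, ((if y ∈ T then 1 else 0) + if y + 1 ∈ T then 1 else 0) := by
    rw [Finset.sum_add_distrib, ← h1, ← h2]; ring
  rw [h5, h4, h3, Finset.mul_sum, ← Finset.sum_add_distrib]
  refine Finset.sum_congr rfl fun y _ => ?_
  by_cases h : y ∈ T <;> by_cases h' : y + 1 ∈ T <;> simp [h, h']

lemma innerBonds_insert (hL : 1 < L) {T : Finset (ZMod L)} {y : ZMod L} (hy : y ∉ T) :
    innerBonds (insert y T) = innerBonds T + lineDeg T y := by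
  have : Fact (1 < L) := ⟨hL⟩
  have h1 : y + 1 ≠ y := by simp
  have h2 : ((insert y T).filter fun x => x + 1 ∈ insert y T)
      = (T.filter fun x => x + 1 ∈ T) ∪ ((T.filter fun x => x = y - 1) ∪
        (({y} : Finset (ZMod L)).filter fun x => x + 1 ∈ T)) := by
    ext x
    have : x + 1 = y ↔ x = y - 1 := eq_sub_iff_add_eq.symm
    simp only [Finset.mem_filter, Finset.mem_insert, Finset.mem_union, Finset.mem_singleton, this]
    constructor
    · rintro ⟨rfl | h, h' | h'⟩
      · exact absurd (eq_sub_iff_add_eq.1 h') h1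
      · tauto
      · tauto
      · tauto
    · tauto
  rw [innerBonds, h2, Finset.card_union_of_disjoint, Finset.card_union_of_disjoint, innerBonds,
    lineDeg]
  · have h3 : ((T.filter fun x => x = y - 1)).card = if y - 1 ∈ T then 1 else 0 := by
      rw [Finset.filter_eq']; split_ifs <;> simp
    have h4 : ((({y} : Finset (ZMod L)).filter fun x => x + 1 ∈ T)).card
        = if y + 1 ∈ T then 1 else 0 := by
      rw [Finset.filter_singleton]; split_ifs <;> simp
    rw [h3, h4]; ring
  · rw [Finset.disjoint_left]
    simp only [Finset.mem_filter, Finset.mem_singleton]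
    rintro x ⟨hx, -⟩ ⟨rfl, -⟩
    exact hy hx
  · rw [Finset.disjoint_left]
    simp only [Finset.mem_filter, Finset.mem_union, Finset.mem_singleton]
    rintro x ⟨hx, hx'⟩ (⟨-, rfl⟩ | ⟨rfl, -⟩)
    · simp at hx'; exact hy hx'
    · exact hy hx

lemma cyc_insert (hL : 1 < L) {T : Finset (ZMod L)} {y : ZMod L} (hy : y ∉ T) :
    cyc (insert y T) + 2 * lineDeg T y = cyc T + 2 := by
  have h1 := cyc_add_innerBonds T
  have h2 := cyc_add_innerBonds (insert y T)
  rw [innerBonds_insert hL hy, Finset.card_insert_of_notMem hy] at h2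
  omega

lemma col_insert (s : Finset (Torus L)) (z : Torus L) (c : ZMod L) :
    col (insert z s) c = if c = z.1 then insert z.2 (col s c) else col s c := by
  ext y
  split_ifs with h <;> simp [Prod.ext_iff, h]

lemma row_insert (s : Finset (Torus L)) (z : Torus L) (r : ZMod L) :
    row (insert z s) r = if r = z.2 then insert z.1 (row s r) else row s r := by
  ext y
  split_ifs with h <;> simp [Prod.ext_iff, h]

/-- Inserting a site alters a single line; both sides are additive to avoid subtraction in ℕ. -/
lemma sum_line_insert {f g : ZMod L → ℕ} {i : ZMod L} {k : ℕ} (hi : f i + 2 * k = g i + 2)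
    (hne : ∀ j ≠ i, f j = g j) : ∑ j, f j + 2 * k = ∑ j, g j + 2 := by
  rw [← Finset.add_sum_erase _ _ (Finset.mem_univ i),
    ← Finset.add_sum_erase Finset.univ g (Finset.mem_univ i),
    Finset.sum_congr rfl fun j hj => hne j (Finset.ne_of_mem_erase hj)]
  change f i + ∑ j ∈ Finset.univ.erase i, g j + 2 * k = g i + ∑ j ∈ Finset.univ.erase i, g j + 2
  omega

lemma perimeter_insert (hL : 1 < L) {s : Finset (Torus L)} {z : Torus L} (hz : z ∉ s) :
    perimeter (insert z s) + 2 * nbrs s z = perimeter s + 4 := by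
  have h1 := sum_line_insert (f := fun c => cyc (col (insert z s) c)) (g := fun c => cyc (col s c))
    (i := z.1) (k := lineDeg (col s z.1) z.2)
    (by simpa only [col_insert, if_true] using cyc_insert hL (by simpa using hz))
    (fun j hj => by simp only [col_insert, if_neg hj])
  have h2 := sum_line_insert (f := fun c => cyc (row (insert z s) c)) (g := fun c => cyc (row s c))
    (i := z.2) (k := lineDeg (row s z.2) z.1)
    (by simpa only [row_insert, if_true] using cyc_insert hL (by simpa using hz))
    (fun j hj => by simp only [row_insert, if_neg hj])
  unfold perimeter nbrs
  omega

/-- For 0 < h < 1 this increment is positive with at most one occupied neighbour and negative with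
at least two. All energy comparisons of single flips rest on this dichotomy. -/
lemma excess_insert (hL : 1 < L) (h : ℝ) {s : Finset (Torus L)} {z : Torus L} (hz : z ∉ s) :
    excess h (insert z s) = excess h s + 8 - 4 * nbrs s z - 2 * h := by
  have h1 : (perimeter (insert z s) : ℝ) + 2 * nbrs s z = perimeter s + 4 := by
    exact_mod_cast perimeter_insert hL hz
  unfold excess
  rw [Finset.card_insert_of_notMem hz]
  push_cast
  linarith

/-! ### Empty and full sets; boundary bonds on the cycle -/

@[simp] lemma cyc_empty : cyc (∅ : Finset (ZMod L)) = 0 := by simp [cyc]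

@[simp] lemma cyc_univ : cyc (Finset.univ : Finset (ZMod L)) = 0 := by simp [cyc]

@[simp] lemma col_empty (c : ZMod L) : col (∅ : Finset (Torus L)) c = ∅ := by ext; simp

@[simp] lemma row_empty (c : ZMod L) : row (∅ : Finset (Torus L)) c = ∅ := by ext; simp

@[simp] lemma excess_empty (h : ℝ) : excess h (∅ : Finset (Torus L)) = 0 := by
  simp [excess, perimeter]

lemma excess_univ (h : ℝ) : excess h (Finset.univ : Finset (Torus L)) = -2 * h * (L : ℝ) ^ 2 := by
  have h1 : ∀ c : ZMod L, col Finset.univ c = Finset.univ := fun c => by ext; simp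
  have h2 : ∀ c : ZMod L, row Finset.univ c = Finset.univ := fun c => by ext; simp
  have h3 : (Finset.univ : Finset (Torus L)).card = L * L := by
    simp [Finset.card_univ, Fintype.card_prod, ZMod.card]
  simp only [excess, perimeter, h1, h2, cyc_univ, h3]
  simp only [Finset.sum_const_zero]
  push_cast
  ring

lemma card_le_sq (s : Finset (Torus L)) : s.card ≤ L * L := by
  have := Finset.card_le_univ s
  simpa [Fintype.card_prod, ZMod.card] using this

lemma excess_univ_le {h : ℝ} (h_pos : 0 < h) (s : Finset (Torus L)) :
    excess h (Finset.univ : Finset (Torus L)) ≤ excess h s := by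
  rw [excess_univ, excess]
  have h1 : (s.card : ℝ) ≤ L * L := by exact_mod_cast card_le_sq s
  have h2 : (0 : ℝ) ≤ perimeter s := Nat.cast_nonneg _
  nlinarith

/-- The full torus minimises the perimeter and maximises the cardinality; since h > 0, it is the
only minimiser of the energy. -/
lemma eq_univ_of_excess_le {h : ℝ} (h_pos : 0 < h) {s : Finset (Torus L)}
    (hs : excess h s ≤ excess h (Finset.univ : Finset (Torus L))) : s = Finset.univ := by
  rw [excess_univ, excess] at hs
  have h2 : (0 : ℝ) ≤ perimeter s := Nat.cast_nonneg _
  have h1 : (L * L : ℝ) ≤ s.card := by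
    by_contra! hlt
    nlinarith
  have h3 : L * L ≤ s.card := by exact_mod_cast h1
  rw [← Finset.card_eq_iff_eq_univ]
  refine le_antisymm (Finset.card_le_univ s) ?_
  simpa [Fintype.card_prod, ZMod.card] using h3

lemma forall_mem_of_succ_mem {T : Finset (ZMod L)} {y : ZMod L} (hy : y ∈ T)
    (h : ∀ x ∈ T, x + 1 ∈ T) (x : ZMod L) : x ∈ T := by
  have key : ∀ n : ℕ, y + n ∈ T := by
    intro n
    induction n with
    | zero => simpa using hy
    | succ n ih => have := h _ ih; push_cast; rwa [← add_assoc]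
  have := key (x - y).val
  rwa [ZMod.natCast_zmod_val, add_sub_cancel] at this

lemma exists_exit {T : Finset (ZMod L)} (hne : T.Nonempty) (hu : T ≠ Finset.univ) :
    ∃ y ∈ T, y + 1 ∉ T := by
  by_contra! h
  obtain ⟨y, hy⟩ := hne
  exact hu (Finset.eq_univ_iff_forall.2 (forall_mem_of_succ_mem hy h))

lemma exists_entry {T : Finset (ZMod L)} (hne : T.Nonempty) (hu : T ≠ Finset.univ) :
    ∃ y ∉ T, y + 1 ∈ T := by
  obtain ⟨y, hy, hy'⟩ := exists_exit (T := Tᶜ)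
    (by rwa [Finset.nonempty_iff_ne_empty, Ne, Finset.compl_eq_empty_iff])
    (by rwa [Ne, Finset.compl_eq_univ_iff, ← Ne, ← Finset.nonempty_iff_ne_empty])
  exact ⟨y, by simpa using hy, by simpa using hy'⟩

lemma two_le_cyc {T : Finset (ZMod L)} (hne : T.Nonempty) (hu : T ≠ Finset.univ) : 2 ≤ cyc T := by
  obtain ⟨y, hy, hy'⟩ := exists_exit hne hu
  obtain ⟨z, hz, hz'⟩ := exists_entry hne hu
  refine Finset.one_lt_card.2 ⟨y, by simp [hy, hy'], z, by simp [hz, hz'], ?_⟩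
  rintro rfl
  exact hz hy

/-- The nonempty columns of `s`. -/
def colSupp (s : Finset (Torus L)) : Finset (ZMod L) := s.image Prod.fst

/-- The nonempty rows of `s`. -/
def rowSupp (s : Finset (Torus L)) : Finset (ZMod L) := s.image Prod.snd

lemma subset_supp (s : Finset (Torus L)) : s ⊆ colSupp s ×ˢ rowSupp s := fun _ hx =>
  Finset.mem_product.2 ⟨Finset.mem_image_of_mem _ hx, Finset.mem_image_of_mem _ hx⟩

lemma card_le_supp (s : Finset (Torus L)) : s.card ≤ (colSupp s).card * (rowSupp s).card := by
  simpa [Finset.card_product] using Finset.card_le_card (subset_supp s)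

lemma col_nonempty {s : Finset (Torus L)} {c : ZMod L} (hc : c ∈ colSupp s) :
    (col s c).Nonempty := by
  obtain ⟨x, hx, rfl⟩ := Finset.mem_image.1 hc
  exact ⟨x.2, by simpa using hx⟩

/-- The reflection of a subset of the torus in the diagonal. -/
def transpose (s : Finset (Torus L)) : Finset (Torus L) := s.map (Equiv.prodComm _ _).toEmbedding

@[simp] lemma mem_transpose {s : Finset (Torus L)} {x : Torus L} :
    x ∈ transpose s ↔ x.swap ∈ s := by
  simp only [transpose, Finset.mem_map_equiv]
  rfl

@[simp] lemma transpose_transpose (s : Finset (Torus L)) : transpose (transpose s) = s := by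
  ext x; simp

@[simp] lemma card_transpose (s : Finset (Torus L)) : (transpose s).card = s.card := by
  simp [transpose]

@[simp] lemma col_transpose (s : Finset (Torus L)) (c : ZMod L) :
    col (transpose s) c = row s c := by
  ext; simp

@[simp] lemma row_transpose (s : Finset (Torus L)) (c : ZMod L) :
    row (transpose s) c = col s c := by
  ext; simp

@[simp] lemma perimeter_transpose (s : Finset (Torus L)) :
    perimeter (transpose s) = perimeter s := by
  simp [perimeter, add_comm]

@[simp] lemma excess_transpose (h : ℝ) (s : Finset (Torus L)) :
    excess h (transpose s) = excess h s := by
  simp [excess]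

@[simp] lemma colSupp_transpose (s : Finset (Torus L)) : colSupp (transpose s) = rowSupp s := by
  ext; simp [colSupp, rowSupp]

@[simp] lemma rowSupp_transpose (s : Finset (Torus L)) : rowSupp (transpose s) = colSupp s := by
  ext; simp [colSupp, rowSupp]

/-- The full columns of `s`. -/
def fullCols (s : Finset (Torus L)) : Finset (ZMod L) :=
  Finset.univ.filter fun c => col s c = Finset.univ

lemma fullCols_subset (s : Finset (Torus L)) : fullCols s ⊆ colSupp s := by
  intro c hc
  have h1 : col s c = Finset.univ := by simpa [fullCols] using hc
  have h2 : (c, 0) ∈ s := by rw [← mem_col, h1]; exact Finset.mem_univ _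
  exact Finset.mem_image.2 ⟨_, h2, rfl⟩

/-- A nonempty column has at least two boundary bonds unless it winds around the torus; full
columns, which have none, are the correction. -/
lemma sum_cyc_col (s : Finset (Torus L)) :
    2 * (colSupp s).card ≤ ∑ c, cyc (col s c) + 2 * (fullCols s).card := by
  have h1 : ∑ c ∈ colSupp s \ fullCols s, 2 ≤ ∑ c ∈ colSupp s \ fullCols s, cyc (col s c) :=
    Finset.sum_le_sum fun c hc => by
      rw [Finset.mem_sdiff] at hc
      exact two_le_cyc (col_nonempty hc.1) (by simpa [fullCols] using hc.2)
  have h2 : ∑ c ∈ colSupp s \ fullCols s, cyc (col s c) ≤ ∑ c, cyc (col s c) :=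
    Finset.sum_le_sum_of_subset (Finset.subset_univ _)
  have h3 := Finset.card_sdiff_add_card_eq_card (fullCols_subset s)
  simp only [Finset.sum_const, smul_eq_mul] at h1
  omega

lemma fullCols_mul_le (s : Finset (Torus L)) : (fullCols s).card * L ≤ s.card := by
  have : fullCols s ×ˢ (Finset.univ : Finset (ZMod L)) ⊆ s := by
    rintro ⟨c, y⟩ hx
    have h1 : col s c = Finset.univ := by simpa [fullCols] using hx
    rw [← mem_col, h1]; exact Finset.mem_univ _
  simpa [Finset.card_product, ZMod.card] using Finset.card_le_card this

/-- A full column meets every row. A winding set thus pays in the other direction. -/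
lemma rowSupp_card_of_full {s : Finset (Torus L)} (h : (fullCols s).Nonempty) :
    (rowSupp s).card = L := by
  obtain ⟨c, hc⟩ := h
  have h1 : col s c = Finset.univ := by simpa [fullCols] using hc
  have : rowSupp s = Finset.univ := Finset.eq_univ_iff_forall.2 fun r =>
    Finset.mem_image.2 ⟨(c, r), by rw [← mem_col, h1]; exact Finset.mem_univ _, rfl⟩
  rw [this, Finset.card_univ, ZMod.card]

/-- A set that is not too large has either a large perimeter or a perimeter bounded below by that
of its bounding box. -/
lemma isoperimetric {l : ℕ} (hl : 2 * l < L) {s : Finset (Torus L)} (hs : s.card ≤ l ^ 2) :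
    4 * l + 2 ≤ perimeter s ∨ 2 * ((colSupp s).card + (rowSupp s).card) ≤ perimeter s := by
  have c1 := sum_cyc_col s
  have r1 := sum_cyc_col (transpose s)
  have c2 := fullCols_mul_le s
  have r2 := fullCols_mul_le (transpose s)
  simp only [card_transpose, colSupp_transpose, col_transpose] at r1 r2
  have c3 := @rowSupp_card_of_full L _ s
  have r3 := @rowSupp_card_of_full L _ (transpose s)
  rw [rowSupp_transpose] at r3
  unfold perimeter
  rcases (fullCols s).eq_empty_or_nonempty with hc | hc <;>
    rcases (fullCols (transpose s)).eq_empty_or_nonempty with hr | hr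
  · rw [hc] at c1; rw [hr] at r1
    simp only [Finset.card_empty, mul_zero, add_zero] at c1 r1
    right; omega
  · rw [hc] at c1
    simp only [Finset.card_empty, mul_zero, add_zero] at c1
    rw [r3 hr] at c1
    left; omega
  · rw [hr] at r1
    simp only [Finset.card_empty, mul_zero, add_zero] at r1
    rw [c3 hc] at r1
    left; omega
  · rw [r3 hr] at c1; rw [c3 hc] at r1
    left
    -- With full lines in both directions all lines are occupied; few of them can be full, since
    -- each takes L > 2l of at most l² sites. The perimeter is then at least 4L - 2l.
    have h1 : ∀ n, n * L ≤ s.card → 2 * n ≤ l := by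
      intro n hn
      by_contra! hlt
      nlinarith
    have h2 := h1 _ c2
    have h3 := h1 _ r2
    omega

end Isoperimetry

/-! ### Rectangles and critical droplets -/

section Droplets

variable {L : ℕ} [NeZero L]

lemma val_add_one_eq (x : ZMod L) : (x + 1).val = if x.val + 1 = L then 0 else x.val + 1 := by
  have hx := ZMod.val_lt x
  have h1 : x + 1 = ((x.val + 1 : ℕ) : ZMod L) := by push_cast; rw [ZMod.natCast_zmod_val]
  rw [h1, ZMod.val_natCast]
  split_ifs with h
  · rw [h, Nat.mod_self]
  · exact Nat.mod_eq_of_lt (by omega)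

/-- The arc of length `a` starting at `u`. -/
def arc (u : ZMod L) (a : ℕ) : Finset (ZMod L) := Finset.univ.filter fun x => (x - u).val < a

@[simp] lemma mem_arc {u x : ZMod L} {a : ℕ} : x ∈ arc u a ↔ (x - u).val < a := by simp [arc]

lemma eq_add_natCast_iff {n : ℕ} (hn : n < L) {x u : ZMod L} : x = u + n ↔ (x - u).val = n := by
  constructor
  · rintro rfl
    rw [add_sub_cancel_left, ZMod.val_natCast_of_lt hn]
  · intro h
    rw [← h, ZMod.natCast_zmod_val, add_sub_cancel]

lemma card_arc (u : ZMod L) {a : ℕ} (ha : a ≤ L) : (arc u a).card = a := by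
  rw [← Finset.card_range a]
  refine Finset.card_nbij' (fun x => (x - u).val) (fun i => u + (i : ZMod L)) ?_ ?_ ?_ ?_
  · intro x hx; simpa using hx
  · intro i hi
    have hi : i < a := by simpa using hi
    simpa [ZMod.val_natCast_of_lt (hi.trans_le ha)] using hi
  · intro x _; simp
  · intro i hi
    have hi : i < a := by simpa using hi
    simp [ZMod.val_natCast_of_lt (hi.trans_le ha)]

/-- A subset of the cycle with only two boundary bonds is an arc. -/
lemma exists_eq_arc {T : Finset (ZMod L)} (hne : T.Nonempty) (hu : T ≠ Finset.univ)
    (hT : cyc T ≤ 2) : ∃ u, T = arc u T.card := by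
  classical
  obtain ⟨e, he, he'⟩ := exists_entry hne hu
  have hL : 0 < L := Nat.pos_of_ne_zero (NeZero.ne L)
  have hsucc : ∀ i : ℕ, e + 1 + ((i + 1 : ℕ) : ZMod L) = e + 1 + i + 1 := fun i => by
    push_cast; ring
  have hlast : e + 1 + ((L - 1 : ℕ) : ZMod L) = e := by
    have h1 : (1 : ZMod L) + ((L - 1 : ℕ) : ZMod L) = ((1 + (L - 1) : ℕ) : ZMod L) := by
      push_cast; rfl
    rw [add_assoc, h1, Nat.add_sub_cancel' hL]; simp
  have hex : ∃ i : ℕ, e + 1 + i ∉ T := ⟨L - 1, by rwa [hlast]⟩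
  set a := Nat.find hex with ha
  -- Here `a` is the length of the run of `T` that starts just after the entry `e`.
  have ha1 : e + 1 + (a : ZMod L) ∉ T := Nat.find_spec hex
  have ha2 : ∀ i < a, e + 1 + (i : ZMod L) ∈ T := fun i hi => not_not.1 (Nat.find_min hex hi)
  have ha3 : a ≤ L - 1 := Nat.find_min' hex (by rwa [hlast])
  have ha4 : 0 < a := by
    rcases Nat.eq_zero_or_pos a with h | h
    · rw [h] at ha1; simp at ha1; exact absurd he' ha1
    · exact h
  have hinj : ∀ i j : ℕ, i < L → j < L → e + 1 + (i : ZMod L) = e + 1 + j → i = j := by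
    intro i j hi hj hij
    have := congrArg ZMod.val (add_left_cancel hij)
    rwa [ZMod.val_natCast_of_lt hi, ZMod.val_natCast_of_lt hj] at this
  have ha5 : ∀ n : ℕ, a + n < L → e + 1 + ((a + n : ℕ) : ZMod L) ∉ T := by
    intro n
    induction n with
    | zero => intro _; exact ha1
    | succ n ih =>
      intro hn hmem
      have h1 := ih (by omega)
      have hlt : a + n + 1 ≠ L - 1 := by
        intro h
        rw [← add_assoc, h, hlast] at hmem
        exact he hmem
      -- Returning to `T` before `e` would give a third boundary bond, besides the entry at `e` and
      -- the end of the first run.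
      have h3 : 2 < cyc T := by
        refine Finset.two_lt_card.2 ⟨e + 1 + ((L - 1 : ℕ) : ZMod L), ?_,
          e + 1 + ((a - 1 : ℕ) : ZMod L), ?_, e + 1 + ((a + n : ℕ) : ZMod L), ?_, ?_, ?_, ?_⟩
        · rw [hlast]; simp [he, he']
        · have h4 := ha2 (a - 1) (by omega)
          have h5 : e + 1 + ((a - 1 : ℕ) : ZMod L) + 1 ∉ T := by
            rw [← hsucc, Nat.sub_add_cancel ha4]; exact ha1
          simp only [Finset.mem_filter, Finset.mem_univ, true_and]
          tauto
        · have h5 : e + 1 + ((a + n : ℕ) : ZMod L) + 1 ∈ T := by rw [← hsucc]; exact hmem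
          simp only [Finset.mem_filter, Finset.mem_univ, true_and]
          tauto
        · intro h; have := hinj _ _ (by omega) (by omega) h; omega
        · intro h; have := hinj _ _ (by omega) (by omega) h; omega
        · intro h; have := hinj _ _ (by omega) (by omega) h; omega
      omega
  have hTa : T = arc (e + 1) a := by
    ext x
    have hx : x = e + 1 + (((x - (e + 1)).val : ℕ) : ZMod L) := by simp
    have hlt := ZMod.val_lt (x - (e + 1))
    rw [mem_arc]
    constructor
    · intro h
      by_contra! h'
      obtain ⟨n, hn⟩ := Nat.exists_eq_add_of_le h'
      rw [hn] at hx hlt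
      exact ha5 n hlt (hx ▸ h)
    · intro h
      rw [hx]; exact ha2 _ h
  refine ⟨e + 1, ?_⟩
  have hcard : T.card = a := by rw [hTa, card_arc _ (by omega)]
  rw [hcard, ← hTa]

lemma perimeter_product (C D : Finset (ZMod L)) :
    perimeter (C ×ˢ D) = C.card * cyc D + D.card * cyc C := by
  have h1 : ∀ c, cyc (col (C ×ˢ D) c) = if c ∈ C then cyc D else 0 := by
    intro c
    split_ifs with h
    · congr 1; ext; simp [h]
    · rw [← cyc_empty (L := L)]; congr 1; ext; simp [h]
  have h2 : ∀ c, cyc (row (C ×ˢ D) c) = if c ∈ D then cyc C else 0 := by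
    intro c
    split_ifs with h
    · congr 1; ext; simp [h]
    · rw [← cyc_empty (L := L)]; congr 1; ext; simp [h]
  simp [perimeter, h1, h2]

lemma ne_univ_of_card_lt {T : Finset (ZMod L)} (h : T.card < L) : T ≠ Finset.univ := by
  rintro rfl
  rw [Finset.card_univ, ZMod.card] at h
  exact lt_irrefl _ h

/-- The optimal sets of cardinality `m (m + 1)` are the quasi-squares. -/
lemma eq_rect_of_perimeter_lt {m : ℕ} (hm : 2 ≤ m) (hL : 2 * (m + 1) < L) {s : Finset (Torus L)}
    (hs : s.card = m * (m + 1)) (hP : perimeter s < 4 * (m + 1)) :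
    ∃ u v, s = arc u m ×ˢ arc v (m + 1) ∨ s = arc u (m + 1) ×ˢ arc v m := by
  have hiso : 2 * ((colSupp s).card + (rowSupp s).card) ≤ perimeter s := by
    rcases isoperimetric hL (s := s) (by rw [hs]; nlinarith) with h | h
    · omega
    · exact h
  have hle := card_le_supp s
  set p := (colSupp s).card with hp
  set q := (rowSupp s).card with hq
  have hpq : p + q ≤ 2 * m + 1 := by omega
  rw [hs] at hle
  -- A product of at least m(m + 1) with sum at most 2m + 1 leaves only the two quasi-square shapes;
  -- then `s` fills its box.
  have hcases : (p = m ∧ q = m + 1) ∨ (p = m + 1 ∧ q = m) := by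
    have h1 : m ≤ p := by
      by_contra! h
      obtain ⟨k, hk⟩ := Nat.exists_eq_add_of_lt h
      have : q ≤ 2 * m + 1 - p := by omega
      have h2 : p * q ≤ p * (2 * m + 1 - p) := Nat.mul_le_mul_left _ this
      have h3 : 2 * m + 1 - p = p + 2 * k + 3 := by omega
      rw [h3] at h2
      nlinarith
    have h2 : m ≤ q := by
      by_contra! h
      obtain ⟨k, hk⟩ := Nat.exists_eq_add_of_lt h
      have : p ≤ 2 * m + 1 - q := by omega
      have h2 : p * q ≤ (2 * m + 1 - q) * q := Nat.mul_le_mul_right _ this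
      have h3 : 2 * m + 1 - q = q + 2 * k + 3 := by omega
      rw [h3] at h2
      nlinarith
    have h3 : ¬ (p = m ∧ q = m) := by
      rintro ⟨h, h'⟩
      rw [h, h'] at hle
      nlinarith
    omega
  have hmul : p * q = m * (m + 1) := by
    rcases hcases with ⟨h, h'⟩ | ⟨h, h'⟩
    · rw [h, h']
    · rw [h, h', mul_comm]
  have heq : s = colSupp s ×ˢ rowSupp s := by
    refine Finset.eq_of_subset_of_card_le (subset_supp s) ?_
    rw [Finset.card_product, hs, ← hp, ← hq, hmul]
  have hpos : 0 < p ∧ 0 < q := by omega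
  have hper := perimeter_product (colSupp s) (rowSupp s)
  rw [← heq, ← hp, ← hq] at hper
  have hC := two_le_cyc (Finset.card_pos.1 (hp ▸ hpos.1))
    (ne_univ_of_card_lt (T := colSupp s) (by omega))
  have hR := two_le_cyc (Finset.card_pos.1 (hq ▸ hpos.2))
    (ne_univ_of_card_lt (T := rowSupp s) (by omega))
  -- A projection with three boundary bonds would add at least m ≥ 2 to the perimeter 2(p + q) = 4m
  -- + 2.
  have hC2 : cyc (colSupp s) ≤ 2 := by
    by_contra! h
    have h1 : p * 2 ≤ p * cyc (rowSupp s) := Nat.mul_le_mul_left _ hR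
    have h2 : q * 3 ≤ q * cyc (colSupp s) := Nat.mul_le_mul_left _ h
    omega
  have hR2 : cyc (rowSupp s) ≤ 2 := by
    by_contra! h
    have h1 : p * 3 ≤ p * cyc (rowSupp s) := Nat.mul_le_mul_left _ h
    have h2 : q * 2 ≤ q * cyc (colSupp s) := Nat.mul_le_mul_left _ hC
    omega
  obtain ⟨u, hu⟩ := exists_eq_arc (Finset.card_pos.1 (hp ▸ hpos.1))
    (ne_univ_of_card_lt (by omega)) hC2
  obtain ⟨v, hv⟩ := exists_eq_arc (Finset.card_pos.1 (hq ▸ hpos.2))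
    (ne_univ_of_card_lt (by omega)) hR2
  refine ⟨u, v, ?_⟩
  rw [← hp] at hu
  rw [← hq] at hv
  rcases hcases with ⟨h, h'⟩ | ⟨h, h'⟩
  · left; rw [h] at hu; rw [h'] at hv; rw [← hu, ← hv]; exact heq
  · right; rw [h] at hu; rw [h'] at hv; rw [← hu, ← hv]; exact heq

/-- The `(m + 1) × (m + 1)` square at `(u, v)`, one of whose vertical sides (the left one if `e`)
is reduced to its `j`-th site: a quasi-square with a protuberance on a longer side. -/
def droplet (m : ℕ) (u v : ZMod L) (e : Bool) (j : ℕ) : Finset (Torus L) :=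
  Finset.univ.filter fun x => (x.1 - u).val < m + 1 ∧ (x.2 - v).val < m + 1 ∧
    ((x.1 - u).val = (if e then 0 else m) → (x.2 - v).val = j)

/-- A quasi-square with a protuberance on a longer side, in either orientation. -/
def critDroplet (m : ℕ) (p : (Torus L) × Bool × Bool × Fin (m + 1)) : Finset (Torus L) :=
  if p.2.1 then transpose (droplet m p.1.2 p.1.1 p.2.2.1 p.2.2.2)
  else droplet m p.1.1 p.1.2 p.2.2.1 p.2.2.2

/-- The set of critical droplets. -/
def critSet (L : ℕ) [NeZero L] (m : ℕ) : Finset (Finset (Torus L)) :=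
  Finset.univ.image (critDroplet m)

lemma droplet_mem_critSet {m : ℕ} (u v : ZMod L) (e : Bool) {j : ℕ} (hj : j < m + 1) :
    droplet m u v e j ∈ critSet L m :=
  Finset.mem_image.2 ⟨((u, v), false, e, ⟨j, hj⟩), Finset.mem_univ _, by simp [critDroplet]⟩

lemma transpose_mem_critSet {m : ℕ} {s : Finset (Torus L)} (hs : s ∈ critSet L m) :
    transpose s ∈ critSet L m := by
  obtain ⟨⟨⟨u, v⟩, o, e, j⟩, -, rfl⟩ := Finset.mem_image.1 hs
  refine Finset.mem_image.2 ⟨((v, u), !o, e, j), Finset.mem_univ _, ?_⟩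
  cases o <;> simp [critDroplet]

lemma mem_critSet_iff {m : ℕ} {s : Finset (Torus L)} : s ∈ critSet L m ↔
    ∃ u v e j, j < m + 1 ∧ (s = droplet m u v e j ∨ s = transpose (droplet m u v e j)) := by
  constructor
  · intro hs
    obtain ⟨⟨⟨u, v⟩, o, e, j⟩, -, rfl⟩ := Finset.mem_image.1 hs
    cases o
    · exact ⟨u, v, e, j, j.2, Or.inl (by simp [critDroplet])⟩
    · exact ⟨v, u, e, j, j.2, Or.inr (by simp [critDroplet])⟩
  · rintro ⟨u, v, e, j, hj, rfl | rfl⟩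
    · exact droplet_mem_critSet u v e hj
    · exact transpose_mem_critSet (droplet_mem_critSet u v e hj)

lemma droplet_right {m : ℕ} (hm : m < L) (u v : ZMod L) {j : ℕ} (hj : j < m + 1) (hjL : j < L) :
    droplet m u v false j = insert (u + (m : ZMod L), v + (j : ZMod L))
      (arc u m ×ˢ arc v (m + 1)) := by
  ext ⟨x, y⟩
  simp only [droplet, Finset.mem_filter, Finset.mem_univ, true_and, Finset.mem_insert,
    Finset.mem_product, mem_arc, Prod.mk.injEq, eq_add_natCast_iff hm, eq_add_natCast_iff hjL]
  simp only [Bool.false_eq_true, if_false]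
  omega

lemma val_sub_add_one {x u : ZMod L} :
    (x - u).val = if (x - (u + 1)).val + 1 = L then 0 else (x - (u + 1)).val + 1 := by
  rw [← val_add_one_eq]; congr 1; ring

lemma droplet_left {m : ℕ} (hm : m + 1 < L) (u v : ZMod L) {j : ℕ} (hj : j < m + 1) :
    droplet m u v true j = insert (u, v + (j : ZMod L)) (arc (u + 1) m ×ˢ arc v (m + 1)) := by
  ext ⟨x, y⟩
  have h0 : x = u ↔ (x - u).val = 0 := by rw [ZMod.val_eq_zero, sub_eq_zero]
  have h1 := val_sub_add_one (x := x) (u := u)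
  have h2 := ZMod.val_lt (x - (u + 1))
  simp only [droplet, Finset.mem_filter, Finset.mem_univ, true_and, Finset.mem_insert,
    Finset.mem_product, mem_arc, Prod.mk.injEq, h0, eq_add_natCast_iff (hj.trans hm)]
  simp only [if_true]
  split_ifs at h1 <;> omega

lemma eq_of_succ_mem_arc {u p : ZMod L} {a : ℕ} (h : p + 1 ∈ arc u a) (hp : p ∉ arc u a) :
    u = p + 1 := by
  rw [mem_arc] at h hp
  have h1 := val_add_one_eq (p - u)
  rw [sub_add_eq_add_sub] at h1
  have h2 := ZMod.val_lt (p - u)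
  split_ifs at h1 with h3
  · rw [ZMod.val_eq_zero, sub_eq_zero] at h1
    exact h1.symm
  · omega

lemma eq_of_pred_mem_arc {u p : ZMod L} {a : ℕ} (h : p - 1 ∈ arc u a) (hp : p ∉ arc u a) :
    p = u + a := by
  rw [mem_arc] at h hp
  have h1 := val_add_one_eq (p - 1 - u)
  have h4 : p - 1 - u + 1 = p - u := by ring
  rw [h4] at h1
  have h2 := ZMod.val_lt (p - 1 - u)
  split_ifs at h1 with h3
  · omega
  · have : (p - u).val = a := by omega
    rw [← this, ZMod.natCast_zmod_val, add_sub_cancel]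

lemma one_le_nbrs {s : Finset (Torus L)} {z : Torus L} (h : 1 ≤ nbrs s z) :
    ((z.1, z.2 + 1) ∈ s ∨ (z.1, z.2 - 1) ∈ s) ∨ ((z.1 + 1, z.2) ∈ s ∨ (z.1 - 1, z.2) ∈ s) := by
  by_contra! hne
  simp [nbrs, lineDeg, hne] at h

lemma transpose_insert (s : Finset (Torus L)) (z : Torus L) :
    transpose (insert z s) = insert z.swap (transpose s) := by
  ext ⟨x, y⟩
  simp [Prod.ext_iff, and_comm]

lemma transpose_product (C D : Finset (ZMod L)) : transpose (C ×ˢ D) = D ×ˢ C := by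
  ext ⟨x, y⟩
  simp [and_comm]

lemma nbrs_transpose (s : Finset (Torus L)) (z : Torus L) :
    nbrs (transpose s) z.swap = nbrs s z := by
  simp [nbrs, add_comm]

lemma colSupp_insert (s : Finset (Torus L)) (z : Torus L) :
    colSupp (insert z s) = insert z.1 (colSupp s) := Finset.image_insert _ _ _

lemma rowSupp_insert (s : Finset (Torus L)) (z : Torus L) :
    rowSupp (insert z s) = insert z.2 (rowSupp s) := Finset.image_insert _ _ _

/-- Sets that are small or fit into the projections of an `m × (m + 2)` rectangle: the dynamics
cannot leave this class below the critical energy. -/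
def Subcritical (m : ℕ) (s : Finset (Torus L)) : Prop :=
  s.card ≤ m * (m + 1) ∨ ((colSupp s).card ≤ m ∧ (rowSupp s).card ≤ m + 2) ∨
    ((colSupp s).card ≤ m + 2 ∧ (rowSupp s).card ≤ m)

lemma Subcritical.transpose {m : ℕ} {s : Finset (Torus L)} (hs : Subcritical m s) :
    Subcritical m (transpose s) := by
  unfold Subcritical at *
  simp only [card_transpose, colSupp_transpose, rowSupp_transpose]
  tauto

lemma Subcritical.mono {m : ℕ} {s t : Finset (Torus L)} (hs : Subcritical m s) (h : t ⊆ s) :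
    Subcritical m t := by
  have h1 := Finset.card_le_card h
  have h2 : (colSupp t).card ≤ (colSupp s).card :=
    Finset.card_le_card (Finset.image_subset_image h)
  have h3 : (rowSupp t).card ≤ (rowSupp s).card :=
    Finset.card_le_card (Finset.image_subset_image h)
  unfold Subcritical at *
  omega

/-- Since m(m + 2) = (m + 1)² - 1, `isoperimetric` with l = m + 1 still applies after one more site
is added. -/
lemma Subcritical.card_le {m : ℕ} {s : Finset (Torus L)} (hs : Subcritical m s) :
    s.card ≤ m * (m + 2) := by
  have h := card_le_supp s
  rcases hs with h1 | ⟨h1, h2⟩ | ⟨h1, h2⟩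
  · nlinarith
  · exact h.trans (Nat.mul_le_mul h1 h2)
  · rw [mul_comm]; exact h.trans (Nat.mul_le_mul h1 h2)

/-- The critical energy: that of a quasi-square `m × (m + 1)` with a protuberance. -/
def critEnergy (h : ℝ) (m : ℕ) : ℝ := 8 * ((m : ℝ) + 1) - 2 * h * ((m : ℝ) ^ 2 + m + 1)

/-- A box with half-perimeter at most 2m + 1 holds at most m(m + 1) sites. -/
lemma perimeter_lower {m : ℕ} (hL : 2 * (m + 1) < L) {s : Finset (Torus L)}
    (h1 : m * (m + 1) < s.card) (h2 : s.card ≤ (m + 1) ^ 2) : 4 * (m + 1) ≤ perimeter s := by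
  rcases isoperimetric hL h2 with h | h
  · omega
  · have h3 := card_le_supp s
    by_contra! hlt
    set p := (colSupp s).card
    set q := (rowSupp s).card
    have hpq : p + q ≤ 2 * m + 1 := by omega
    have h4 : m * (m + 1) < p * q := by omega
    have h5 : q ≤ 2 * m + 1 - p := by omega
    have h6 : p * q ≤ p * (2 * m + 1 - p) := Nat.mul_le_mul_left _ h5
    rcases le_or_gt p m with h7 | h7
    · obtain ⟨k, rfl⟩ := Nat.exists_eq_add_of_le h7
      have h8 : 2 * (p + k) + 1 - p = p + 2 * k + 1 := by omega
      rw [h8] at h6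
      nlinarith
    · obtain ⟨k, hk⟩ := Nat.exists_eq_add_of_le h7
      rcases le_or_gt p (2 * m + 1) with h9 | h9
      · obtain ⟨r, hr⟩ := Nat.exists_eq_add_of_le h9
        have h8 : 2 * m + 1 - p = r := by omega
        rw [h8] at h6
        have h10 : m = k + r := by omega
        subst h10
        nlinarith
      · have h8 : 2 * m + 1 - p = 0 := by omega
        rw [h8] at h6
        omega

/-- Adding a neighbour to a quasi-square gives a critical droplet or a subcritical set. -/
lemma rect_insert {m : ℕ} (hL : 2 * (m + 1) < L) {u v : ZMod L} {z : Torus L}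
    (hz : z ∉ arc u m ×ˢ arc v (m + 1)) (hn : 1 ≤ nbrs (arc u m ×ˢ arc v (m + 1)) z) :
    Subcritical m (insert z (arc u m ×ˢ arc v (m + 1))) ∨
      insert z (arc u m ×ˢ arc v (m + 1)) ∈ critSet L m := by
  obtain ⟨p, q⟩ := z
  rw [Finset.mem_product] at hz
  -- A site in an occupied column sits on a shorter side, and the result still fits the projections
  -- of an m × (m + 2) box.
  have hsub : ∀ x, (p, x) ∈ arc u m ×ˢ arc v (m + 1) →
      Subcritical m (insert (p, q) (arc u m ×ˢ arc v (m + 1))) := by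
    intro x hx
    refine Or.inr (Or.inl ⟨?_, ?_⟩)
    · rw [colSupp_insert]
      refine (Finset.card_le_card (Finset.insert_subset (Finset.mem_product.1 hx).1
        (t := arc u m) ?_)).trans_eq (card_arc u (by omega))
      intro c hc
      obtain ⟨y, hy, rfl⟩ := Finset.mem_image.1 hc
      exact (Finset.mem_product.1 hy).1
    · rw [rowSupp_insert]
      have h1 : rowSupp (arc u m ×ˢ arc v (m + 1)) ⊆ arc v (m + 1) := by
        intro c hc
        obtain ⟨y, hy, rfl⟩ := Finset.mem_image.1 hc
        exact (Finset.mem_product.1 hy).2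
      have h2 := Finset.card_le_card h1
      rw [card_arc v (by omega)] at h2
      exact (Finset.card_insert_le _ _).trans (by omega)
  have hj : ∀ {y : ZMod L}, y ∈ arc v (m + 1) → y = v + (((y - v).val : ℕ) : ZMod L) :=
    fun _ => by simp
  rcases one_le_nbrs hn with (h | h) | (h | h)
  · exact Or.inl (hsub _ h)
  · exact Or.inl (hsub _ h)
  · right
    rw [Finset.mem_product] at h
    have hp : p ∉ arc u m := fun hp => hz ⟨hp, h.2⟩
    have hu := eq_of_succ_mem_arc h.1 hp
    have hq : (q - v).val < m + 1 := mem_arc.1 h.2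
    have := droplet_left (by omega : m + 1 < L) p v hq
    rw [← hj h.2, ← hu] at this
    rw [← this]
    exact droplet_mem_critSet _ _ _ hq
  · right
    rw [Finset.mem_product] at h
    have hp : p ∉ arc u m := fun hp => hz ⟨hp, h.2⟩
    have hu := eq_of_pred_mem_arc h.1 hp
    have hq : (q - v).val < m + 1 := mem_arc.1 h.2
    have := droplet_right (by omega : m < L) u v hq (by omega)
    rw [← hj h.2, ← hu] at this
    rw [← this]
    exact droplet_mem_critSet _ _ _ hq

end Droplets

/-! ### The energy barrier -/

section Barrier

variable {L : ℕ} [NeZero L]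

/-- Only the two ends of an arc contribute. Empty and full arcs have no boundary, hence an
inequality; it also covers rectangles that wind around the torus. -/
lemma cyc_arc_le (u : ZMod L) (a : ℕ) : cyc (arc u a) ≤ 2 := by
  have : (Finset.univ.filter fun y => ¬ (y ∈ arc u a ↔ y + 1 ∈ arc u a)) ⊆ {u - 1, u + a - 1} := by
    intro y hy
    simp only [Finset.mem_filter, Finset.mem_univ, true_and] at hy
    simp only [Finset.mem_insert, Finset.mem_singleton]
    by_cases h : y ∈ arc u a
    · right
      have h1 : y + 1 ∉ arc u a := by tauto
      rw [← eq_of_pred_mem_arc (by simpa using h) h1]; ring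
    · left
      have h1 : y + 1 ∈ arc u a := by tauto
      rw [eq_of_succ_mem_arc h1 h]; ring
  exact (Finset.card_le_card this).trans Finset.card_le_two

lemma excess_rect_le (h : ℝ) (u v : ZMod L) {a b : ℕ} (ha : a ≤ L) (hb : b ≤ L) :
    excess h (arc u a ×ˢ arc v b) ≤ 4 * ((a : ℝ) + b) - 2 * h * (a * b) := by
  have h1 : perimeter (arc u a ×ˢ arc v b) ≤ 2 * (a + b) := by
    rw [perimeter_product, card_arc u ha, card_arc v hb]
    have h1 := Nat.mul_le_mul_left a (cyc_arc_le v b)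
    have h2 := Nat.mul_le_mul_left b (cyc_arc_le u a)
    omega
  have h2 : (perimeter (arc u a ×ˢ arc v b) : ℝ) ≤ 2 * (a + b) := by exact_mod_cast h1
  unfold excess
  rw [Finset.card_product, card_arc u ha, card_arc v hb]
  push_cast
  linarith

/-- Every critical droplet is, up to transposition, a quasi-square with one more site. -/
lemma droplet_eq_insert {m : ℕ} (hm : 2 ≤ m) (hL : 2 * (m + 1) < L) (u v : ZMod L) (e : Bool)
    {j : ℕ} (hj : j < m + 1) :
    ∃ (u' c d : ZMod L), droplet m u v e j = insert (c, d) (arc u' m ×ˢ arc v (m + 1)) ∧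
      c ∉ arc u' m ∧ (c + 1 ∈ arc u' m ∨ c - 1 ∈ arc u' m) ∧ d ∈ arc v (m + 1) ∧
      insert c (arc u' m) = arc u (m + 1) := by
  have hd : v + (j : ZMod L) ∈ arc v (m + 1) := by
    simpa [ZMod.val_natCast_of_lt (show j < L by omega)] using hj
  cases e
  · refine ⟨u, u + (m : ZMod L), v + (j : ZMod L), droplet_right (by omega) u v hj (by omega),
      ?_, Or.inr ?_, hd, ?_⟩
    · simp [ZMod.val_natCast_of_lt (show m < L by omega)]
    · have h1 : u + (m : ZMod L) - 1 - u = ((m - 1 : ℕ) : ZMod L) := by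
        rw [Nat.cast_sub (by omega)]; push_cast; ring
      rw [mem_arc, h1, ZMod.val_natCast_of_lt (by omega)]; omega
    · ext x
      simp only [Finset.mem_insert, mem_arc, eq_add_natCast_iff (show m < L by omega)]
      omega
  · refine ⟨u + 1, u, v + (j : ZMod L), droplet_left (by omega) u v hj, ?_, Or.inl ?_, hd, ?_⟩
    · have h1 := val_sub_add_one (x := u) (u := u)
      simp only [sub_self, ZMod.val_zero] at h1
      rw [mem_arc]
      split_ifs at h1
      omega
    · simp; omega
    · ext x
      have h0 : x = u ↔ (x - u).val = 0 := by rw [ZMod.val_eq_zero, sub_eq_zero]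
      have h1 := val_sub_add_one (x := x) (u := u)
      have h2 := ZMod.val_lt (x - (u + 1))
      simp only [Finset.mem_insert, mem_arc, h0]
      split_ifs at h1 <;> omega

lemma one_le_nbrs_product {C D : Finset (ZMod L)} {c d : ZMod L}
    (h : c + 1 ∈ C ∨ c - 1 ∈ C) (hd : d ∈ D) : 1 ≤ nbrs (C ×ˢ D) (c, d) := by
  unfold nbrs lineDeg
  simp only [mem_row, mem_col, Finset.mem_product, hd, and_true]
  rcases h with h | h <;> simp [h] <;> omega

lemma critEnergy_le_of_card {m : ℕ} (hL : 2 * (m + 1) < L) (h : ℝ) {s : Finset (Torus L)}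
    (hs : s.card = m * (m + 1) + 1) : critEnergy h m ≤ excess h s := by
  have h1 := perimeter_lower hL (s := s) (by omega) (by rw [hs]; nlinarith)
  have h2 : (4 * ((m : ℝ) + 1)) ≤ perimeter s := by exact_mod_cast h1
  unfold critEnergy excess
  rw [hs]
  push_cast
  nlinarith

lemma excess_droplet {m : ℕ} (hm : 2 ≤ m) (hL : 2 * (m + 1) < L) (h : ℝ) (u v : ZMod L) (e : Bool)
    {j : ℕ} (hj : j < m + 1) : excess h (droplet m u v e j) = critEnergy h m := by
  obtain ⟨u', c, d, h1, h2, h3, h4, -⟩ := droplet_eq_insert hm hL u v e hj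
  have h5 : (c, d) ∉ arc u' m ×ˢ arc v (m + 1) := fun hx => h2 (Finset.mem_product.1 hx).1
  rw [h1]
  refine le_antisymm ?_ (critEnergy_le_of_card hL h ?_)
  · rw [excess_insert (by omega) h h5]
    have h6 := excess_rect_le h u' v (show m ≤ L by omega) (show m + 1 ≤ L by omega)
    have h7 : (1 : ℝ) ≤ nbrs (arc u' m ×ˢ arc v (m + 1)) (c, d) := by
      exact_mod_cast one_le_nbrs_product h3 h4
    unfold critEnergy
    push_cast at h6
    nlinarith
  · rw [Finset.card_insert_of_notMem h5, Finset.card_product, card_arc _ (by omega),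
      card_arc _ (by omega)]

lemma excess_of_mem_critSet {m : ℕ} (hm : 2 ≤ m) (hL : 2 * (m + 1) < L) (h : ℝ)
    {s : Finset (Torus L)} (hs : s ∈ critSet L m) : excess h s = critEnergy h m := by
  obtain ⟨u, v, e, j, hj, rfl | rfl⟩ := mem_critSet_iff.1 hs
  · exact excess_droplet hm hL h u v e hj
  · rw [excess_transpose]; exact excess_droplet hm hL h u v e hj

lemma critEnergy_pos {m : ℕ} {h : ℝ} (h_pos : 0 < h) (h_lt : h < 1) (hh : h * m ≤ 2) :
    0 < critEnergy h m := by
  unfold critEnergy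
  have : (0 : ℝ) ≤ m := Nat.cast_nonneg _
  nlinarith

/-- Leaving the class of subcritical sets by one added site. -/
lemma subcritical_insert {m : ℕ} (hm : 2 ≤ m) (hL : 2 * (m + 1) < L) {h : ℝ} (h_pos : 0 < h)
    (hh : h * m ≤ 2) {s : Finset (Torus L)} (hs : Subcritical m s) {z : Torus L} (hz : z ∉ s)
    (hE : excess h s ≤ critEnergy h m) (hE' : excess h (insert z s) ≤ critEnergy h m) :
    Subcritical m (insert z s) ∨ insert z s ∈ critSet L m ∨
      (excess h (insert z s) = critEnergy h m ∧ h * m = 2) := by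
  have hcard := Finset.card_insert_of_notMem hz
  rcases Nat.lt_or_ge (m * (m + 1)) s.card with hlarge | hsmall
  -- Above m(m + 1) sites, `s` must use exactly m columns and m + 2 rows when it leaves the box, up
  -- to transposition.
  · have box : ∀ (s : Finset (Torus L)) (z : Torus L), z ∉ s → m * (m + 1) < s.card →
        (colSupp s).card ≤ m → (rowSupp s).card ≤ m + 2 →
        excess h (insert z s) ≤ critEnergy h m → Subcritical m (insert z s) ∨
        (excess h (insert z s) = critEnergy h m ∧ h * m = 2) := by
      intro s z hz hlarge hc hr hE'
      have hcard := Finset.card_insert_of_notMem hz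
      have hc' := Finset.card_insert_le z.1 (colSupp s)
      have hr' := Finset.card_insert_le z.2 (rowSupp s)
      rw [← colSupp_insert] at hc'
      rw [← rowSupp_insert] at hr'
      by_cases hsub : (colSupp (insert z s)).card ≤ m ∧ (rowSupp (insert z s)).card ≤ m + 2
      · exact Or.inl (Or.inr (Or.inl hsub))
      right
      have hle := card_le_supp s
      have hr2 : (rowSupp s).card = m + 2 := by
        by_contra hne
        have : (rowSupp s).card ≤ m + 1 := by omega
        have := Nat.mul_le_mul hc this
        omega
      have hc2 : (colSupp s).card = m := by
        by_contra hne
        obtain ⟨k, rfl⟩ := Nat.exists_eq_add_of_le (show 1 ≤ m by omega)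
        have : (colSupp s).card ≤ k := by omega
        have := Nat.mul_le_mul this hr
        nlinarith
      have hmono1 : (colSupp s).card ≤ (colSupp (insert z s)).card :=
        Finset.card_le_card (Finset.image_subset_image (Finset.subset_insert _ _))
      have hmono2 : (rowSupp s).card ≤ (rowSupp (insert z s)).card :=
        Finset.card_le_card (Finset.image_subset_image (Finset.subset_insert _ _))
      rw [hr2, hc2] at hle
      have hcard2 : (insert z s).card ≤ (m + 1) ^ 2 := by rw [hcard]; nlinarith
      have hP : 4 * (m + 1) + 2 ≤ perimeter (insert z s) := by
        rcases isoperimetric hL hcard2 with h1 | h1 <;> omega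
      have hP' : (4 * ((m : ℝ) + 1) + 2) ≤ perimeter (insert z s) := by exact_mod_cast hP
      have hN' : ((insert z s).card : ℝ) ≤ ((m : ℝ) + 1) ^ 2 := by exact_mod_cast hcard2
      -- Perimeter at least 4m + 6 with at most (m + 1)² sites; the surplus 4 - 2hm vanishes only if
      -- hm = 2.
      have hge : critEnergy h m + (4 - 2 * (h * m)) ≤ excess h (insert z s) := by
        unfold critEnergy excess
        nlinarith
      exact ⟨by linarith, by linarith⟩
    rcases hs with h1 | ⟨h1, h2⟩ | ⟨h1, h2⟩
    · omega
    · rcases box s z hz hlarge h1 h2 hE' with h3 | h3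
      · exact Or.inl h3
      · exact Or.inr (Or.inr h3)
    · have := box (transpose s) z.swap (by simpa using hz) (by simpa using hlarge)
        (by simpa using h2) (by simpa using h1)
        (by rw [← transpose_insert, excess_transpose]; exact hE')
      rw [← transpose_insert, excess_transpose] at this
      rcases this with h3 | h3
      · left; simpa using h3.transpose
      · exact Or.inr (Or.inr h3)
  · by_cases hsub : (insert z s).card ≤ m * (m + 1)
    · exact Or.inl (Or.inl hsub)
    have hN : s.card = m * (m + 1) := by omega
    have hN' : (insert z s).card = m * (m + 1) + 1 := by omega
    -- At exactly m(m + 1) sites the energy bound forces a quasi-square.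
    have hP : perimeter s < 4 * (m + 1) := by
      have : (perimeter s : ℝ) < 4 * (m + 1) := by
        unfold excess critEnergy at hE
        rw [hN] at hE
        push_cast at hE
        nlinarith
      exact_mod_cast this
    have hP' : perimeter (insert z s) ≤ 4 * (m + 1) := by
      have : (perimeter (insert z s) : ℝ) ≤ 4 * (m + 1) := by
        unfold excess critEnergy at hE'
        rw [hN'] at hE'
        push_cast at hE'
        nlinarith
      exact_mod_cast this
    have hflip := perimeter_insert (by omega : 1 < L) hz
    have hlow : 4 * m + 2 ≤ perimeter s := by
      have hle := card_le_supp s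
      rcases isoperimetric hL (s := s) (by rw [hN]; nlinarith) with h1 | h1
      · omega
      · by_contra! hlt
        have h2 : (colSupp s).card + (rowSupp s).card ≤ 2 * m := by omega
        rw [hN] at hle
        nlinarith [sq_nonneg (((colSupp s).card : ℤ) - (rowSupp s).card)]
    -- An isolated new site would raise the perimeter from at least 4m + 2 by 4.
    have hn : 1 ≤ nbrs s z := by omega
    obtain ⟨u, v, rfl | rfl⟩ := eq_rect_of_perimeter_lt hm hL hN hP
    · rcases rect_insert hL hz hn with h1 | h1
      · exact Or.inl h1
      · exact Or.inr (Or.inl h1)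
    · have h0 : transpose (arc u (m + 1) ×ˢ arc v m) = arc v m ×ˢ arc u (m + 1) :=
        transpose_product _ _
      have hz' : z.swap ∉ arc v m ×ˢ arc u (m + 1) := by rw [← h0]; simpa using hz
      have hn' : 1 ≤ nbrs (arc v m ×ˢ arc u (m + 1)) z.swap := by
        rw [← h0, nbrs_transpose]; exact hn
      have h2 := rect_insert hL hz' hn'
      rw [← h0, ← transpose_insert] at h2
      rcases h2 with h1 | h1
      · left; simpa using h1.transpose
      · right; left; simpa using transpose_mem_critSet h1

/-- Subcritical sets have positive energy. -/
lemma Subcritical.excess_pos {m : ℕ} (hm : 2 ≤ m) (hL : 2 * (m + 1) < L) {h : ℝ} (h_pos : 0 < h)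
    (h_lt : h < 1) (hh : h * m ≤ 2) {s : Finset (Torus L)} (hs : Subcritical m s)
    (hne : s.Nonempty) : 0 < excess h s := by
  have hN := hs.card_le
  have hNpos : (0 : ℝ) < s.card := by exact_mod_cast hne.card_pos
  have hN1 : (s.card : ℝ) ≤ m * (m + 2) := by exact_mod_cast hN
  have hm' : (2 : ℝ) ≤ m := by exact_mod_cast hm
  have hP : h * s.card < perimeter s := by
    rcases isoperimetric hL (s := s) (by nlinarith) with h1 | h1
    · have h2 : (4 * ((m : ℝ) + 1) + 2) ≤ perimeter s := by exact_mod_cast h1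
      have h3 : h * s.card ≤ h * (m * (m + 2)) := mul_le_mul_of_nonneg_left hN1 h_pos.le
      nlinarith
    · have h2 : 2 * (((colSupp s).card : ℝ) + (rowSupp s).card) ≤ perimeter s := by
        exact_mod_cast h1
      have h3 : (s.card : ℝ) ≤ (colSupp s).card * (rowSupp s).card := by
        exact_mod_cast card_le_supp s
      -- With p and q the sides of the box, (h|s|)² ≤ 8|s| ≤ 8pq ≤ 2(p + q)², which is less than
      -- (2(p + q))².
      have h4 : h * (h * s.card) ≤ 8 := by
        have : h * s.card ≤ 2 * (m + 2) := by nlinarith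
        nlinarith
      have h5 : (0 : ℝ) ≤ ((colSupp s).card : ℝ) + (rowSupp s).card := by positivity
      refine lt_of_lt_of_le ?_ h2
      refine lt_of_pow_lt_pow_left₀ 2 (by positivity) ?_
      nlinarith [sq_nonneg (((colSupp s).card : ℝ) - (rowSupp s).card)]
  unfold excess
  linarith

lemma nbrs_congr {Q : Torus L → Prop} {s t : Finset (Torus L)} (hst : ∀ w, Q w → (w ∈ s ↔ w ∈ t))
    {z : Torus L} (h1 : Q (z.1, z.2 + 1)) (h2 : Q (z.1, z.2 - 1)) (h3 : Q (z.1 + 1, z.2))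
    (h4 : Q (z.1 - 1, z.2)) : nbrs s z = nbrs t z := by
  simp [nbrs, lineDeg, hst _ h1, hst _ h2, hst _ h3, hst _ h4]

/-- Flipping back the sites at which two sets differ costs opposite nonzero energies. -/
lemma flip_lowers (hL : 1 < L) {h : ℝ} (h_pos : 0 < h) (h_lt : h < 1) {s t : Finset (Torus L)}
    {z : Torus L} (hs : z ∉ s) (ht : z ∈ t) (hn : nbrs s z = nbrs (t.erase z) z) :
    excess h (insert z s) < excess h s ∨ excess h (t.erase z) < excess h t := by
  have h1 := excess_insert hL h hs
  have h2 := excess_insert hL h (Finset.notMem_erase z t)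
  rw [Finset.insert_erase ht, ← hn] at h2
  rw [h1, h2]
  rcases Nat.lt_or_ge (nbrs s z) 2 with h3 | h3
  · right
    have : (nbrs s z : ℝ) ≤ 1 := by exact_mod_cast Nat.lt_succ_iff.1 h3
    linarith
  · left
    have : (2 : ℝ) ≤ nbrs s z := by exact_mod_cast h3
    linarith

/-- If a class of sets is stable under admissible single flips, then it is stable under
admissible simultaneous flips on one sublattice. -/
lemma class_stable (hL : 1 < L) {h Γ : ℝ} (h_pos : 0 < h) (h_lt : h < 1)
    {Q : Torus L → Prop} (hQ : ∀ z : Torus L, ¬ Q z →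
      Q (z.1, z.2 + 1) ∧ Q (z.1, z.2 - 1) ∧ Q (z.1 + 1, z.2) ∧ Q (z.1 - 1, z.2))
    {Ok Cl : Finset (Torus L) → Prop} (hOk : ∀ s, excess h s < Γ → Ok s)
    (hOk' : ∀ s, Ok s → excess h s ≤ Γ)
    (hins : ∀ s z, z ∉ s → Cl s → Ok s → Ok (insert z s) → Cl (insert z s))
    (hera : ∀ s z, z ∉ s → Cl (insert z s) → Cl s) :
    ∀ (n : ℕ) (s t : Finset (Torus L)), (symmDiff s t).card = n →
      (∀ w, Q w → (w ∈ s ↔ w ∈ t)) → Cl s → Ok s → Ok t → Cl t := by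
  intro n
  -- A differing site z has all its neighbours in `Q`, where `s` and `t` agree, so z sees the same
  -- neighbourhood in both. By `flip_lowers` one of the two sets can be changed at z to agree with
  -- the other while its energy drops, hence it stays admissible and one difference disappears.
  induction n with
  | zero =>
    intro s t hn _ hs _ _
    rw [Finset.card_eq_zero, ← Finset.bot_eq_empty, symmDiff_eq_bot] at hn
    rwa [← hn]
  | succ n ih =>
    intro s t hn hst hs hos hot
    obtain ⟨z, hz⟩ := Finset.card_pos.1 (by rw [hn]; exact Nat.succ_pos n)
    have hzQ : ¬ Q z := fun hq => by
      have := hst z hq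
      rw [Finset.mem_symmDiff] at hz
      tauto
    obtain ⟨q1, q2, q3, q4⟩ := hQ z hzQ
    have hcard : ∀ s' t' : Finset (Torus L), symmDiff s' t' = (symmDiff s t).erase z →
        (symmDiff s' t').card = n := fun s' t' h' => by
      rw [h', Finset.card_erase_of_mem hz, hn]; rfl
    have hsub : ∀ {w : Torus L}, Q w → w ≠ z := fun hw hwz => hzQ (hwz ▸ hw)
    rcases Finset.mem_symmDiff.1 hz with ⟨hzs, hzt⟩ | ⟨hzt, hzs⟩
    · have agree1 : ∀ w, Q w → (w ∈ s.erase z ↔ w ∈ t) := fun w hw => by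
        rw [Finset.mem_erase, ← hst w hw]; simp [hsub hw]
      have agree2 : ∀ w, Q w → (w ∈ s ↔ w ∈ insert z t) := fun w hw => by
        rw [Finset.mem_insert, ← hst w hw]; simp [hsub hw]
      have hnb : nbrs t z = nbrs (s.erase z) z :=
        (nbrs_congr (Q := Q) agree1 q1 q2 q3 q4).symm
      rcases flip_lowers hL h_pos h_lt hzt hzs hnb with hlow | hlow
      · have hok : Ok (insert z t) := hOk _ (hlow.trans_le (hOk' _ hot))
        have := ih s (insert z t) (hcard _ _ (by
          ext w; simp only [Finset.mem_symmDiff, Finset.mem_insert, Finset.mem_erase]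
          by_cases hw : w = z
          · subst hw; tauto
          · tauto)) agree2 hs hos hok
        exact hera t z hzt this
      · have hok : Ok (s.erase z) := hOk _ (hlow.trans_le (hOk' _ hos))
        have hcl : Cl (s.erase z) :=
          hera _ z (Finset.notMem_erase z s) (by rwa [Finset.insert_erase hzs])
        exact ih (s.erase z) t (hcard _ _ (by
          ext w; simp only [Finset.mem_symmDiff, Finset.mem_erase]
          by_cases hw : w = z
          · subst hw; tauto
          · tauto)) agree1 hcl hok hot
    · have agree1 : ∀ w, Q w → (w ∈ s ↔ w ∈ t.erase z) := fun w hw => by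
        rw [Finset.mem_erase, ← hst w hw]; simp [hsub hw]
      have agree2 : ∀ w, Q w → (w ∈ insert z s ↔ w ∈ t) := fun w hw => by
        rw [Finset.mem_insert, ← hst w hw]; simp [hsub hw]
      have hnb : nbrs s z = nbrs (t.erase z) z := nbrs_congr (Q := Q) agree1 q1 q2 q3 q4
      rcases flip_lowers hL h_pos h_lt hzs hzt hnb with hlow | hlow
      · have hok : Ok (insert z s) := hOk _ (hlow.trans_le (hOk' _ hos))
        exact ih (insert z s) t (hcard _ _ (by
          ext w; simp only [Finset.mem_symmDiff, Finset.mem_insert, Finset.mem_erase]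
          by_cases hw : w = z
          · subst hw; tauto
          · tauto)) agree2 (hins s z hzs hs hos hok) hok hot
      · have hok : Ok (t.erase z) := hOk _ (hlow.trans_le (hOk' _ hot))
        have := ih s (t.erase z) (hcard _ _ (by
          ext w; simp only [Finset.mem_symmDiff, Finset.mem_erase]
          by_cases hw : w = z
          · subst hw; tauto
          · tauto)) agree1 hs hos hok
        have h2 := hins _ z (Finset.notMem_erase z t) this hok
        rw [Finset.insert_erase hzt] at h2
        exact h2 hot

end Barrier

/-! ### Counting the critical droplets -/

section Counting

variable {L : ℕ} [NeZero L]

lemma mem_droplet_add {m : ℕ} {u v : ZMod L} {e : Bool} {j i k : ℕ} (hi : i < L) (hk : k < L) :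
    (u + (i : ZMod L), v + (k : ZMod L)) ∈ droplet m u v e j ↔
      i < m + 1 ∧ k < m + 1 ∧ (i = (if e then 0 else m) → k = j) := by
  simp [droplet, ZMod.val_natCast_of_lt hi, ZMod.val_natCast_of_lt hk]

lemma colSupp_droplet {m : ℕ} (hL : 2 * (m + 1) < L) (u v : ZMod L) (e : Bool) {j : ℕ}
    (hj : j < m + 1) : colSupp (droplet m u v e j) = arc u (m + 1) := by
  ext x
  simp only [colSupp, Finset.mem_image, mem_arc]
  constructor
  · rintro ⟨y, hy, rfl⟩
    simp only [droplet, Finset.mem_filter, Finset.mem_univ, true_and] at hy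
    exact hy.1
  · intro hx
    refine ⟨(x, v + (j : ZMod L)), ?_, rfl⟩
    simp [droplet, ZMod.val_natCast_of_lt (show j < L by omega)]
    omega

lemma rowSupp_droplet {m : ℕ} (hm : 2 ≤ m) (hL : 2 * (m + 1) < L) (u v : ZMod L) (e : Bool)
    {j : ℕ} : rowSupp (droplet m u v e j) = arc v (m + 1) := by
  ext y
  simp only [rowSupp, Finset.mem_image, mem_arc]
  constructor
  · rintro ⟨y, hy, rfl⟩
    simp only [droplet, Finset.mem_filter, Finset.mem_univ, true_and] at hy
    exact hy.2.1
  · intro hy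
    refine ⟨(u + ((1 : ℕ) : ZMod L), y), ?_, rfl⟩
    simp only [droplet, Finset.mem_filter, Finset.mem_univ, true_and, add_sub_cancel_left,
      ZMod.val_natCast_of_lt (show 1 < L by omega)]
    refine ⟨by omega, hy, fun h => ?_⟩
    split_ifs at h
    omega

lemma arc_injective {a : ℕ} (ha : 0 < a) (ha' : a < L) {u u' : ZMod L} (h : arc u a = arc u' a) :
    u = u' := by
  have h1 : u ∈ arc u' a := by rw [← h]; simp [ha]
  have h2 : u - 1 ∉ arc u' a := by
    rw [← h, mem_arc]
    have := val_add_one_eq (u - 1 - u)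
    have h3 : u - 1 - u + 1 = 0 := by ring
    rw [h3, ZMod.val_zero] at this
    split_ifs at this
    omega
  have := eq_of_succ_mem_arc (by simpa using h1) h2
  simpa using this.symm

lemma droplet_injective {m : ℕ} (hm : 2 ≤ m) (hL : 2 * (m + 1) < L) {u v : ZMod L} {e e' : Bool}
    {j j' : ℕ} (hj : j < m + 1) (h : droplet m u v e j = droplet m u v e' j') :
    e = e' ∧ j = j' := by
  have key : ∀ i k : ℕ, i < m + 1 → k < m + 1 →
      ((i = (if e then 0 else m) → k = j) ↔ (i = (if e' then 0 else m) → k = j')) := by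
    intro i k hi hk
    have h1 := mem_droplet_add (m := m) (u := u) (v := v) (e := e) (j := j)
      (show i < L by omega) (show k < L by omega)
    rw [h, mem_droplet_add (show i < L by omega) (show k < L by omega)] at h1
    tauto
  have k1 := key 0 0 (by omega) (by omega)
  have k2 := key 0 1 (by omega) (by omega)
  have k3 := key 0 j (by omega) hj
  have k4 := key m j (by omega) hj
  cases e <;> cases e' <;> simp at k1 k2 k3 k4 ⊢ <;> omega

/-- The m ≥ 2 sites missing from the square lie in one column for a droplet and in one row for a
transposed one. -/
lemma droplet_ne_transpose {m : ℕ} (hm : 2 ≤ m) (hL : 2 * (m + 1) < L) {u v : ZMod L}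
    {e e' : Bool} {j j' : ℕ} : droplet m u v e j ≠ transpose (droplet m v u e' j') := by
  intro h
  have key : ∀ i k : ℕ, i < m + 1 → k < m + 1 →
      ((i = (if e then 0 else m) → k = j) ↔ (k = (if e' then 0 else m) → i = j')) := by
    intro i k hi hk
    have h1 := mem_droplet_add (m := m) (u := u) (v := v) (e := e) (j := j)
      (show i < L by omega) (show k < L by omega)
    rw [h, mem_transpose, Prod.swap_prod_mk,
      mem_droplet_add (show k < L by omega) (show i < L by omega)] at h1
    tauto
  have hi : ∀ e : Bool, (if e then 0 else m) < m + 1 := fun e => by cases e <;> simp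
  have k1 := key _ 0 (hi e) (by omega)
  have k2 := key _ 1 (hi e) (by omega)
  have k3 := key _ 2 (hi e) (by omega)
  have k4 := key _ m (hi e) (by omega)
  cases e' <;> simp at k1 k2 k3 k4 <;> omega

/-- The projections recover the corner of the square; the missing sites then determine orientation,
side and protuberance. -/
lemma critDroplet_injective {m : ℕ} (hm : 2 ≤ m) (hL : 2 * (m + 1) < L) :
    Function.Injective (critDroplet (L := L) m) := by
  have hcol : ∀ p, colSupp (critDroplet (L := L) m p) = arc p.1.1 (m + 1) := by
    rintro ⟨⟨u, v⟩, o, e, j⟩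
    cases o
    · simpa [critDroplet] using colSupp_droplet hL u v e j.2
    · simpa [critDroplet] using rowSupp_droplet hm hL v u e
  have hrow : ∀ p, rowSupp (critDroplet (L := L) m p) = arc p.1.2 (m + 1) := by
    rintro ⟨⟨u, v⟩, o, e, j⟩
    cases o
    · simpa [critDroplet] using rowSupp_droplet hm hL u v e
    · simpa [critDroplet] using colSupp_droplet hL v u e j.2
  intro p p' h
  have hu : p.1.1 = p'.1.1 := arc_injective (a := m + 1) (by omega) (by omega)
    (by rw [← hcol, ← hcol, h])
  have hv : p.1.2 = p'.1.2 := arc_injective (a := m + 1) (by omega) (by omega)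
    (by rw [← hrow, ← hrow, h])
  obtain ⟨⟨u, v⟩, o, e, j⟩ := p
  obtain ⟨⟨u', v'⟩, o', e', j'⟩ := p'
  simp only at hu hv
  subst hu hv
  have hdone : e = e' ∧ (j : ℕ) = j' → o = o' →
      (((u, v), o, e, j) : Torus L × Bool × Bool × Fin (m + 1)) = ((u, v), o', e', j') := by
    rintro ⟨rfl, hj⟩ rfl
    rw [Fin.ext hj]
  cases o <;> cases o'
  · exact hdone (droplet_injective hm hL j.2 (by simpa [critDroplet] using h)) rfl
  · exact absurd (by simpa [critDroplet] using h) (droplet_ne_transpose hm hL)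
  · exact absurd (by simpa [critDroplet] using h.symm) (droplet_ne_transpose hm hL)
  · refine hdone (droplet_injective hm hL (u := v) (v := u) j.2 ?_) rfl
    have := congrArg transpose h
    simpa [critDroplet] using this

lemma card_critSet {m : ℕ} (hm : 2 ≤ m) (hL : 2 * (m + 1) < L) :
    (critSet L m).card = 4 * (m + 1) * L ^ 2 := by
  rw [critSet, Finset.card_image_of_injective _ (critDroplet_injective hm hL), Finset.card_univ]
  simp only [Fintype.card_prod, ZMod.card, Fintype.card_bool, Fintype.card_fin]
  ring

end Counting

/-! ### Growth of droplets -/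

section Growth

variable {L : ℕ} [NeZero L]

/-- `t` is obtained from `s` by adding sites one at a time, through sets with energy in `K`. -/
def Grow (h : ℝ) (K : Set ℝ) : Finset (Torus L) → Finset (Torus L) → Prop :=
  Relation.ReflTransGen fun s t => excess h t ∈ K ∧ ∃ z ∉ s, t = insert z s

lemma Grow.transpose {h : ℝ} {K : Set ℝ} {s t : Finset (Torus L)} (hst : Grow h K s t) :
    Grow h K (transpose s) (transpose t) := by
  induction hst with
  | refl => exact Relation.ReflTransGen.refl
  | tail _ hstep ih =>
    obtain ⟨hK, z, hz, rfl⟩ := hstep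
    refine ih.tail ⟨by rwa [excess_transpose], z.swap, by simpa using hz, transpose_insert _ _⟩

/-- Sites with at least two occupied neighbours can be filled without raising the energy. -/
lemma grow_fill (hL : 1 < L) {h : ℝ} (h_pos : 0 < h) {K : Set ℝ} (hK : IsLowerSet K)
    {T : Finset (Torus L)} (n : ℕ) : ∀ w₀ : Finset (Torus L), (T \ w₀).card = n → w₀ ⊆ T →
      excess h w₀ ∈ K →
      (∀ w, w₀ ⊆ w → w ⊆ T → w ≠ T → ∃ y ∈ T, y ∉ w ∧ 2 ≤ nbrs w y) → Grow h K w₀ T := by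
  induction n with
  | zero =>
    intro w hn hw _ _
    have : T ⊆ w := Finset.sdiff_eq_empty_iff_subset.1 (Finset.card_eq_zero.1 hn)
    rw [Finset.Subset.antisymm hw this]
    exact Relation.ReflTransGen.refl
  | succ n ih =>
    intro w hn hw hE H
    have hne : w ≠ T := by rintro rfl; simp at hn
    obtain ⟨y, hyT, hyw, hy⟩ := H w subset_rfl hw hne
    have hE' : excess h (insert y w) ∈ K := by
      refine hK ?_ hE
      rw [excess_insert hL h hyw]
      have : (2 : ℝ) ≤ nbrs w y := by exact_mod_cast hy
      linarith
    refine Relation.ReflTransGen.head ⟨hE', y, hyw, rfl⟩ (ih _ ?_ ?_ hE' ?_)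
    · rw [Finset.sdiff_insert, Finset.card_erase_of_mem (Finset.mem_sdiff.2 ⟨hyT, hyw⟩), hn]; rfl
    · exact Finset.insert_subset hyT hw
    · exact fun w' hw' => H w' ((Finset.subset_insert _ _).trans hw')

/-- A discrete intermediate value principle; in `grow_line` it finds the next site to fill, on
either side of the occupied ones. -/
lemma exists_adjacent_change {p : ℕ → Prop} {a b n : ℕ} (ha : p a) (hb : ¬ p b) (han : a ≤ n)
    (hbn : b ≤ n) : ∃ i < n, (p i ∧ ¬ p (i + 1)) ∨ (¬ p i ∧ p (i + 1)) := by
  by_contra! H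
  have key : ∀ i ≤ n, (p i ↔ p 0) := by
    intro i
    induction i with
    | zero => simp
    | succ i ih =>
      intro hi
      have := H i (by omega)
      have := ih (by omega)
      tauto
  have h1 := key a han
  have h2 := key b hbn
  tauto

lemma two_le_nbrs {s : Finset (Torus L)} {z : Torus L}
    (h1 : (z.1, z.2 + 1) ∈ s ∨ (z.1, z.2 - 1) ∈ s)
    (h2 : (z.1 + 1, z.2) ∈ s ∨ (z.1 - 1, z.2) ∈ s) : 2 ≤ nbrs s z := by
  unfold nbrs lineDeg
  simp only [mem_row, mem_col]
  rcases h1 with h1 | h1 <;> rcases h2 with h2 | h2 <;> simp only [h1, h2, if_true] <;> omega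

/-- A line attached to a rectangle can be filled once it holds a site. -/
lemma grow_line (hL : 1 < L) {h : ℝ} (h_pos : 0 < h) {K : Set ℝ} (hK : IsLowerSet K)
    {C : Finset (ZMod L)} {c d v : ZMod L} {b : ℕ} (hb : b ≤ L)
    (hC : c + 1 ∈ C ∨ c - 1 ∈ C) (hd : d ∈ arc v b)
    {w : Finset (Torus L)} (hw : insert (c, d) (C ×ˢ arc v b) ⊆ w)
    (hw' : w ⊆ insert c C ×ˢ arc v b) (hE : excess h w ∈ K) :
    Grow h K w (insert c C ×ˢ arc v b) := by
  refine grow_fill hL h_pos hK _ w rfl hw' hE fun w₁ h1 h2 h3 => ?_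
  have hsub := hw.trans h1
  obtain ⟨⟨x, y⟩, hxy, hxy'⟩ : ∃ x ∈ insert c C ×ˢ arc v b, x ∉ w₁ := by
    by_contra! H
    exact h3 (Finset.Subset.antisymm h2 H)
  have hmemC : ∀ x ∈ C, ∀ y ∈ arc v b, (x, y) ∈ w₁ := fun x hx y hy =>
    hsub (Finset.mem_insert_of_mem (Finset.mem_product.2 ⟨hx, hy⟩))
  rw [Finset.mem_product, Finset.mem_insert] at hxy
  have hxc : x = c := by
    rcases hxy.1 with h4 | h4
    · exact h4
    · exact absurd (hmemC x h4 y hxy.2) hxy'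
  subst hxc
  have hdv : v + (((d - v).val : ℕ) : ZMod L) = d := by simp
  have hyv : v + (((y - v).val : ℕ) : ZMod L) = y := by simp
  have hdb := mem_arc.1 hd
  have hyb : (y - v).val < b := mem_arc.1 hxy.2
  obtain ⟨i, hi, hcase⟩ := exists_adjacent_change (p := fun i : ℕ => (x, v + (i : ZMod L)) ∈ w₁)
    (a := (d - v).val) (b := (y - v).val) (n := b - 1)
    (by simp only [hdv]; exact hsub (Finset.mem_insert_self _ _))
    (by simp only [hyv]; exact hxy') (by omega) (by omega)
  have harc : ∀ k < b, v + (k : ZMod L) ∈ arc v b := fun k hk => by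
    simpa [ZMod.val_natCast_of_lt (hk.trans_le hb)] using hk
  have hrow : ∀ k < b, (x + 1, v + (k : ZMod L)) ∈ w₁ ∨ (x - 1, v + (k : ZMod L)) ∈ w₁ :=
    fun k hk => hC.imp (fun h => hmemC _ h _ (harc k hk)) (fun h => hmemC _ h _ (harc k hk))
  rcases hcase with ⟨h4, h5⟩ | ⟨h4, h5⟩
  · refine ⟨(x, v + ((i + 1 : ℕ) : ZMod L)), Finset.mem_product.2
      ⟨Finset.mem_insert_self _ _, harc _ (by omega)⟩, h5,
      two_le_nbrs (Or.inr ?_) (hrow _ (by omega))⟩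
    have h6 : v + ((i + 1 : ℕ) : ZMod L) - 1 = v + (i : ZMod L) := by push_cast; ring
    simpa only [h6] using h4
  · refine ⟨(x, v + (i : ZMod L)), Finset.mem_product.2
      ⟨Finset.mem_insert_self _ _, harc _ (by omega)⟩, h4,
      two_le_nbrs (Or.inl ?_) (hrow _ (by omega))⟩
    have h6 : v + ((i + 1 : ℕ) : ZMod L) = v + (i : ZMod L) + 1 := by push_cast; ring
    simpa only [h6] using h5

/-- A bound for the energy of an `a × b` rectangle with a protuberance. -/
def peak (h : ℝ) (a b : ℕ) : ℝ := 4 * ((a : ℝ) + b) - 2 * h * (a * b) + 4 - 2 * h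

lemma insert_arc {u : ZMod L} {a : ℕ} (ha : a < L) :
    insert (u + (a : ZMod L)) (arc u a) = arc u (a + 1) := by
  ext x
  simp only [Finset.mem_insert, mem_arc, eq_add_natCast_iff ha]
  omega

lemma add_natCast_notMem_arc {u : ZMod L} {a : ℕ} (ha : a < L) :
    u + (a : ZMod L) ∉ arc u a := by
  simp [ZMod.val_natCast_of_lt ha]

lemma self_mem_arc {u : ZMod L} {a : ℕ} (ha : 0 < a) : u ∈ arc u a := by simpa using ha

/-- Only the first site of the new line raises the energy, by at most 4 - 2h; every later site has
two occupied neighbours. -/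
lemma grow_right (hL : 1 < L) {h : ℝ} (h_pos : 0 < h) {K : Set ℝ} (hK : IsLowerSet K)
    (u v : ZMod L) {a b : ℕ} (ha : 0 < a) (haL : a < L) (hb : 0 < b) (hbL : b ≤ L)
    (hpk : peak h a b ∈ K) : Grow h K (arc u a ×ˢ arc v b) (arc u (a + 1) ×ˢ arc v b) := by
  have hz : (u + (a : ZMod L), v) ∉ arc u a ×ˢ arc v b := fun hx =>
    add_natCast_notMem_arc haL (Finset.mem_product.1 hx).1
  have hC : u + (a : ZMod L) + 1 ∈ arc u a ∨ u + (a : ZMod L) - 1 ∈ arc u a := by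
    right
    have h1 : u + (a : ZMod L) - 1 - u = ((a - 1 : ℕ) : ZMod L) := by
      rw [Nat.cast_sub (by omega)]; push_cast; ring
    rw [mem_arc, h1, ZMod.val_natCast_of_lt (by omega)]; omega
  have hE : excess h (insert (u + (a : ZMod L), v) (arc u a ×ˢ arc v b)) ∈ K := by
    refine hK ?_ hpk
    rw [excess_insert hL h hz]
    have h1 := excess_rect_le h u v haL.le hbL
    have h2 : (1 : ℝ) ≤ nbrs (arc u a ×ˢ arc v b) (u + (a : ZMod L), v) := by
      exact_mod_cast one_le_nbrs_product hC (self_mem_arc hb)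
    unfold peak
    linarith
  refine Relation.ReflTransGen.head ⟨hE, _, hz, rfl⟩ ?_
  rw [← insert_arc haL]
  refine grow_line hL h_pos hK hbL hC (self_mem_arc hb) subset_rfl ?_ hE
  refine Finset.insert_subset (Finset.mem_product.2 ⟨Finset.mem_insert_self _ _,
    self_mem_arc hb⟩) (Finset.product_subset_product_left (Finset.subset_insert _ _))

lemma peak_comm (h : ℝ) (a b : ℕ) : peak h a b = peak h b a := by unfold peak; ring

lemma grow_right_iter (hL : 1 < L) {h : ℝ} (h_pos : 0 < h) {K : Set ℝ} (hK : IsLowerSet K)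
    (u v : ZMod L) {a b : ℕ} (ha : 0 < a) (hb : 0 < b) (hbL : b ≤ L) (n : ℕ) (hn : a + n ≤ L)
    (hpk : ∀ i < n, peak h (a + i) b ∈ K) :
    Grow h K (arc u a ×ˢ arc v b) (arc u (a + n) ×ˢ arc v b) := by
  induction n with
  | zero => exact Relation.ReflTransGen.refl
  | succ n ih =>
    exact (ih (by omega) fun i hi => hpk i (by omega)).trans
      (grow_right hL h_pos hK u v (by omega) (by omega) hb hbL (hpk n (by omega)))

lemma grow_up_iter (hL : 1 < L) {h : ℝ} (h_pos : 0 < h) {K : Set ℝ} (hK : IsLowerSet K)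
    (u v : ZMod L) {a b : ℕ} (ha : 0 < a) (haL : a ≤ L) (hb : 0 < b) (n : ℕ) (hn : b + n ≤ L)
    (hpk : ∀ i < n, peak h a (b + i) ∈ K) :
    Grow h K (arc u a ×ˢ arc v b) (arc u a ×ˢ arc v (b + n)) := by
  have := (grow_right_iter hL h_pos hK v u hb ha haL n hn
    fun i hi => peak_comm h _ _ ▸ hpk i hi).transpose
  rwa [transpose_product, transpose_product] at this

/-- Nucleation of the critical quasi-square. -/
lemma grow_quasiSquare {m : ℕ} (hm : 2 ≤ m) (hL : 2 * (m + 1) < L) {h : ℝ} (h_pos : 0 < h)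
    (h_lt : h < 1) (hh : h * m ≤ 2) {K : Set ℝ} (hK : IsLowerSet K) (hpk : peak h m m ∈ K)
    (u v : ZMod L) : Grow h K ∅ (arc u m ×ˢ arc v (m + 1)) := by
  have hL1 : 1 < L := by omega
  -- Below the critical length the peaks increase with the sides, as 4 - 2hm ≥ 0, so the last one,
  -- at m × m, dominates.
  have hup : ∀ b : ℕ, b ≤ m → peak h m b ∈ K := fun b hb => by
    refine hK ?_ hpk
    have : (b : ℝ) ≤ m := by exact_mod_cast hb
    unfold peak
    nlinarith
  have hright : ∀ a : ℕ, a ≤ m → peak h a 1 ∈ K := fun a ha => by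
    refine hK ?_ (hup 1 (by omega))
    have : (a : ℝ) ≤ m := by exact_mod_cast ha
    unfold peak
    push_cast
    nlinarith
  have hone : arc u 1 ×ˢ arc v 1 = insert (u, v) (∅ : Finset (Torus L)) := by
    ext ⟨x, y⟩
    simp [ZMod.val_eq_zero, sub_eq_zero]
  have h0 : Grow h K ∅ (arc u 1 ×ˢ arc v 1) := by
    refine Relation.ReflTransGen.single ⟨?_, (u, v), Finset.notMem_empty _, hone⟩
    refine hK ?_ (hright 1 (by omega))
    have := excess_rect_le h u v (show 1 ≤ L by omega) (show 1 ≤ L by omega)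
    unfold peak
    push_cast at this ⊢
    linarith
  have h1 := grow_right_iter hL1 h_pos hK u v one_pos one_pos (by omega) (m - 1) (by omega)
    fun i hi => hright (1 + i) (by omega)
  have h2 := grow_up_iter hL1 h_pos hK u v (show 0 < m by omega) (by omega) one_pos m (by omega)
    fun i hi => hup (1 + i) (by omega)
  rw [show 1 + (m - 1) = m by omega] at h1
  rw [add_comm 1 m] at h2
  exact (h0.trans h1).trans h2

/-- Growth of a supercritical square to the whole torus. -/
lemma grow_square {m : ℕ} (hL : 2 * (m + 1) < L) {h : ℝ} (h_pos : 0 < h)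
    (hh : 2 < h * (m + 1)) {K : Set ℝ} (hK : IsLowerSet K) (hpk : peak h (m + 1) (m + 1) ∈ K)
    (u v : ZMod L) : Grow h K (arc u (m + 1) ×ˢ arc v (m + 1)) Finset.univ := by
  have hL1 : 1 < L := by omega
  -- Beyond the critical length lengthening a side lowers the peak, since h(m + 1) > 2.
  have hpeak : ∀ a b : ℕ, m + 1 ≤ a → m + 1 ≤ b → peak h a b ∈ K := fun a b ha hb => by
    refine hK ?_ hpk
    have ha' : (m : ℝ) + 1 ≤ a := by exact_mod_cast ha
    have hb' : (m : ℝ) + 1 ≤ b := by exact_mod_cast hb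
    have h1 : peak h a b ≤ peak h a (m + 1) := by
      unfold peak
      push_cast
      have : 2 ≤ h * a := by nlinarith
      nlinarith
    have h2 : peak h a (m + 1) ≤ peak h (m + 1) (m + 1) := by
      unfold peak
      push_cast
      nlinarith
    exact h1.trans h2
  have h1 := grow_right_iter hL1 h_pos hK u v (show 0 < m + 1 by omega) (show 0 < m + 1 by omega)
    (by omega) (L - (m + 1)) (by omega) fun i _ => hpeak _ _ (by omega) le_rfl
  have h2 := grow_up_iter hL1 h_pos hK u v (show 0 < L by omega) le_rfl (show 0 < m + 1 by omega)
    (L - (m + 1)) (by omega) fun i _ => hpeak _ _ (by omega) (by omega)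
  rw [show m + 1 + (L - (m + 1)) = L by omega] at h1 h2
  have huniv : arc u L ×ˢ arc v L = Finset.univ := by
    ext x; simp [ZMod.val_lt]
  rw [huniv] at h2
  exact h1.trans h2

/-- The even sublattice. -/
def EvenSite (x : Torus L) : Prop := Even (x.1.val + x.2.val)

lemma even_val_add_one (hL : Even L) (x : ZMod L) (n : ℕ) :
    Even ((x + 1).val + n) ↔ ¬ Even (x.val + n) := by
  rw [val_add_one_eq]
  split_ifs with h
  · rw [Nat.even_iff] at hL ⊢
    rw [Nat.even_iff]
    omega
  · rw [Nat.even_iff, Nat.even_iff]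
    omega

lemma evenSite_right (hL : Even L) (x y : ZMod L) : EvenSite (x + 1, y) ↔ ¬ EvenSite (x, y) :=
  even_val_add_one hL x _

lemma evenSite_up (hL : Even L) (x y : ZMod L) : EvenSite (x, y + 1) ↔ ¬ EvenSite (x, y) := by
  unfold EvenSite
  simp only [add_comm x.val]
  exact even_val_add_one hL y _

lemma evenSite_left (hL : Even L) (x y : ZMod L) : EvenSite (x - 1, y) ↔ ¬ EvenSite (x, y) := by
  have := evenSite_right hL (x - 1) y
  rw [sub_add_cancel] at this
  tauto

lemma evenSite_down (hL : Even L) (x y : ZMod L) : EvenSite (x, y - 1) ↔ ¬ EvenSite (x, y) := by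
  have := evenSite_up hL x (y - 1)
  rw [sub_add_cancel] at this
  tauto

lemma evenSite_swap (x : Torus L) : EvenSite x.swap ↔ EvenSite x := by
  simp [EvenSite, add_comm]

/-- A critical droplet `insert z R` arises from the empty set below the critical energy except for
its last site `z`, and after the addition of a further site `y`, of the other parity, it grows to
the whole torus below the critical energy. -/
lemma critical_passage {m : ℕ} (hm : 2 ≤ m) (hL : 2 * (m + 1) < L) (hLe : Even L) {h : ℝ}
    (h_pos : 0 < h) (h_lt : h < 1) (hh : h * m < 2) (hh' : 2 < h * (m + 1))
    {s : Finset (Torus L)} (hs : s ∈ critSet L m) :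
    ∃ (R : Finset (Torus L)) (z y : Torus L), z ∉ R ∧ s = insert z R ∧ y ∉ s ∧
      (EvenSite y ↔ ¬ EvenSite z) ∧ Grow h (Set.Iio (critEnergy h m)) ∅ R ∧
      excess h (insert y s) < critEnergy h m ∧
      Grow h (Set.Iio (critEnergy h m)) (insert y s) Finset.univ := by
  have hL1 : 1 < L := by omega
  have hK : IsLowerSet (Set.Iio (critEnergy h m)) := isLowerSet_Iio _
  have key : ∀ (u v : ZMod L) (e : Bool) (j : ℕ), j < m + 1 →
      ∃ (R : Finset (Torus L)) (z y : Torus L), z ∉ R ∧ droplet m u v e j = insert z R ∧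
        y ∉ droplet m u v e j ∧ (EvenSite y ↔ ¬ EvenSite z) ∧
        Grow h (Set.Iio (critEnergy h m)) ∅ R ∧
        excess h (insert y (droplet m u v e j)) < critEnergy h m ∧
        Grow h (Set.Iio (critEnergy h m)) (insert y (droplet m u v e j)) Finset.univ := by
    intro u v e j hj
    obtain ⟨u', c, d, h1, h2, h3, h4, h5⟩ := droplet_eq_insert hm hL u v e hj
    have hz : (c, d) ∉ arc u' m ×ˢ arc v (m + 1) := fun hx => h2 (Finset.mem_product.1 hx).1
    -- The next site is the neighbour of the protuberance along its side: upwards if there is room,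
    -- otherwise downwards. It touches both the protuberance and the rectangle, so filling it lowers
    -- the energy.
    obtain ⟨y, hy, hyd, hyn, hyp⟩ : ∃ y ∈ arc v (m + 1), y ≠ d ∧ (y + 1 = d ∨ y - 1 = d) ∧
        (EvenSite (c, y) ↔ ¬ EvenSite (c, d)) := by
      have hne : ∀ x : ZMod L, x + 1 ≠ x := fun x => by
        have : Fact (1 < L) := ⟨hL1⟩
        simp
      by_cases hlt : (d - v).val < m
      · refine ⟨d + 1, ?_, hne d, Or.inr (by ring), evenSite_up hLe c d⟩
        have := val_add_one_eq (d - v)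
        rw [sub_add_eq_add_sub] at this
        rw [mem_arc, this]
        split_ifs <;> omega
      · refine ⟨d - 1, ?_, fun h0 => hne (d - 1) (by rw [sub_add_cancel]; exact h0.symm),
          Or.inl (by ring), evenSite_down hLe c d⟩
        have := val_add_one_eq (d - 1 - v)
        rw [show d - 1 - v + 1 = d - v by ring] at this
        have h6 := mem_arc.1 h4
        rw [mem_arc]
        split_ifs at this <;> omega
    have hys : (c, y) ∉ droplet m u v e j := by
      rw [h1, Finset.mem_insert, Finset.mem_product]
      rintro (h6 | h6)
      · exact hyd (Prod.mk.inj h6).2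
      · exact h2 h6.1
    have hE : excess h (insert (c, y) (droplet m u v e j)) < critEnergy h m := by
      rw [excess_insert hL1 h hys, excess_droplet hm hL h u v e hj]
      have h6 : 2 ≤ nbrs (droplet m u v e j) (c, y) := by
        rw [h1]
        refine two_le_nbrs ?_ ?_
        · rcases hyn with h6 | h6
          · left; rw [h6]; exact Finset.mem_insert_self _ _
          · right; rw [h6]; exact Finset.mem_insert_self _ _
        · exact h3.imp
            (fun h7 => Finset.mem_insert_of_mem (Finset.mem_product.2 ⟨h7, hy⟩))
            (fun h7 => Finset.mem_insert_of_mem (Finset.mem_product.2 ⟨h7, hy⟩))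
      have h7 : (2 : ℝ) ≤ nbrs (droplet m u v e j) (c, y) := by exact_mod_cast h6
      linarith
    refine ⟨arc u' m ×ˢ arc v (m + 1), (c, d), (c, y), hz, h1, hys, hyp, ?_, hE, ?_⟩
    -- The peak at m × m lies 4 - 2hm below the critical energy.
    · refine grow_quasiSquare hm hL h_pos h_lt hh.le hK ?_ u' v
      simp only [Set.mem_Iio, peak, critEnergy]
      nlinarith
    · have h6 : Grow h (Set.Iio (critEnergy h m)) (insert (c, y) (droplet m u v e j))
          (insert c (arc u' m) ×ˢ arc v (m + 1)) := by
        refine grow_line hL1 h_pos hK (by omega) h3 h4 ?_ ?_ hE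
        · rw [h1]; exact Finset.subset_insert _ _
        · rw [h1]
          refine Finset.insert_subset ?_ (Finset.insert_subset ?_ ?_)
          · exact Finset.mem_product.2 ⟨Finset.mem_insert_self _ _, hy⟩
          · exact Finset.mem_product.2 ⟨Finset.mem_insert_self _ _, h4⟩
          · exact Finset.product_subset_product_left (Finset.subset_insert _ _)
      refine h6.trans ?_
      rw [h5]
      -- The peak at (m + 1) × (m + 1) lies 2(h(m + 1) - 2) below the critical energy.
      refine grow_square hL h_pos hh' hK ?_ u v
      simp only [Set.mem_Iio, peak, critEnergy]
      push_cast
      nlinarith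
  obtain ⟨u, v, e, j, hj, rfl | rfl⟩ := mem_critSet_iff.1 hs
  · exact key u v e j hj
  · obtain ⟨R, z, y, g1, g2, g3, g4, g5, g6, g7⟩ := key u v e j hj
    have huniv : transpose (Finset.univ : Finset (Torus L)) = Finset.univ := by ext; simp
    have hemp : transpose (∅ : Finset (Torus L)) = ∅ := by ext; simp
    refine ⟨transpose R, z.swap, y.swap, by simpa using g1, by rw [g2, transpose_insert],
      by simpa using g3, by rw [evenSite_swap, evenSite_swap]; exact g4, ?_, ?_, ?_⟩
    · simpa [hemp] using g5.transpose
    · rw [← transpose_insert, excess_transpose]; exact g6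
    · rw [← transpose_insert, ← huniv]; exact g7.transpose

/-- The torus can be filled at the critical energy. -/
lemma grow_univ {m : ℕ} (hm : 2 ≤ m) (hL : 2 * (m + 1) < L) {h : ℝ} (h_pos : 0 < h)
    (h_lt : h < 1) (hh : h * m ≤ 2) (hh' : 2 < h * (m + 1)) :
    Grow h (Set.Iic (critEnergy h m)) (∅ : Finset (Torus L)) Finset.univ := by
  have hL1 : 1 < L := by omega
  have hK : IsLowerSet (Set.Iic (critEnergy h m)) := isLowerSet_Iic _
  have h1 := grow_quasiSquare hm hL h_pos h_lt hh hK (by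
    simp only [Set.mem_Iic, peak, critEnergy]; nlinarith) (0 : ZMod L) 0
  -- The peak of this step is exactly `critEnergy h m`.
  have h2 := grow_right hL1 h_pos hK (0 : ZMod L) 0 (a := m) (b := m + 1) (by omega) (by omega)
    (by omega) (by omega) (by
      simp only [Set.mem_Iic, peak, critEnergy]; push_cast; nlinarith)
  have h3 := grow_square hL h_pos hh' hK (by
    simp only [Set.mem_Iic, peak, critEnergy]; push_cast; nlinarith) (0 : ZMod L) 0
  exact (h1.trans h2).trans h3

end Growth

/-! ### The two Ising configurations behind a transition -/

section Mixing

variable {L : ℕ} [NeZero L]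

/-- The set of pluses of a configuration. -/
def plusSet (σ : Config L) : Finset (Torus L) := Finset.univ.filter fun x => σ x = 1

/-- The configuration with a given set of pluses. -/
def conf (s : Finset (Torus L)) : Config L := fun x => if x ∈ s then 1 else -1

open Classical in
/-- The configuration that agrees with `σ` on the even and with `η` on the odd sublattice. -/
def mix (σ η : Config L) : Config L := fun x => if EvenSite x then σ x else η x

/-- The energy of the pair of Ising configurations attached to the transition from `σ` to `η`. -/
def pairEnergy (h : ℝ) (σ η : Config L) : ℝ :=
  excess h (plusSet (mix σ η)) + excess h (plusSet (mix η σ))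

lemma pairEnergy_comm (h : ℝ) (σ η : Config L) : pairEnergy h σ η = pairEnergy h η σ :=
  add_comm _ _

@[simp] lemma mem_plusSet {σ : Config L} {x : Torus L} : x ∈ plusSet σ ↔ σ x = 1 := by
  simp [plusSet]

@[simp] lemma plusSet_conf (s : Finset (Torus L)) : plusSet (conf s) = s := by
  ext x
  by_cases h : x ∈ s <;> simp [conf, h]

@[simp] lemma conf_plusSet (σ : Config L) : conf (plusSet σ) = σ := by
  funext x
  rcases Int.units_eq_one_or (σ x) with h | h <;> simp [conf, h]

-- Mixing is an involution on pairs, so transitions correspond bijectively to pairs of Ising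
-- configurations.
@[simp] lemma mix_mix (σ η : Config L) : mix (mix σ η) (mix η σ) = σ := by
  funext x
  by_cases h : EvenSite x <;> simp [mix, h]

lemma mix_self (σ : Config L) : mix σ σ = σ := by
  funext x
  simp [mix]

lemma pairEnergy_mix (h : ℝ) (s q : Finset (Torus L)) :
    pairEnergy h (mix (conf s) (conf q)) (mix (conf q) (conf s)) = excess h s + excess h q := by
  simp [pairEnergy]

lemma conf_empty : conf (∅ : Finset (Torus L)) = allMinus L := by
  funext x; simp [conf, allMinus]

lemma conf_univ : conf (Finset.univ : Finset (Torus L)) = allPlus L := by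
  funext x; simp [conf, allPlus]

lemma checkerEven_eq : checkerEven L = mix (allPlus L) (allMinus L) := by
  funext x
  by_cases h : EvenSite x
  · simp only [mix, h, if_true, checkerEven, allPlus]; exact Even.neg_one_pow h
  · simp only [mix, h, if_false, checkerEven, allMinus]
    exact Odd.neg_one_pow (Nat.not_even_iff_odd.1 h)

lemma checkerOdd_eq : checkerOdd L = mix (allMinus L) (allPlus L) := by
  funext x
  by_cases h : EvenSite x
  · simp only [mix, h, if_true, checkerOdd, allMinus]; exact Odd.neg_one_pow (Even.add_one h)
  · simp only [mix, h, if_false, checkerOdd, allPlus]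
    exact Even.neg_one_pow (Odd.add_one (Nat.not_even_iff_odd.1 h))

/-! ### The weight of a transition -/

@[simp] lemma spin_one : spin 1 = 1 := by simp [spin]

@[simp] lemma spin_neg_one : spin (-1) = -1 := by simp [spin]

/-- The four displacements are distinct once L > 2. -/
lemma kernel_eq (hL : 2 < L) (z : Torus L) : kernel z =
    (if z = (1, 0) then 1 else 0) + (if z = (-1, 0) then 1 else 0) +
      (if z = (0, 1) then 1 else 0) + (if z = (0, -1) then 1 else 0) := by
  have : Fact (1 < L) := ⟨by omega⟩
  have : Fact (2 < L) := ⟨hL⟩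
  have h1 : (1 : ZMod L) ≠ -1 := (ZMod.neg_one_ne_one).symm
  have h0 : (1 : ZMod L) ≠ 0 := one_ne_zero
  have h0' : (-1 : ZMod L) ≠ 0 := neg_ne_zero.2 one_ne_zero
  unfold kernel
  by_cases a : z = (1, 0)
  · subst a; simp [h1]
  by_cases b : z = (-1, 0)
  · subst b; simp [h1.symm]
  by_cases c : z = (0, 1)
  · subst c; simp [h1, h0.symm]
  by_cases d : z = (0, -1)
  · subst d; simp [h1.symm, h0.symm]
  simp [a, b, c, d]

lemma localField_eq (hL : 2 < L) (σ : Config L) (x : Torus L) : localField σ x =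
    spin (σ (x - (1, 0))) + spin (σ (x + (1, 0))) + spin (σ (x - (0, 1))) +
      spin (σ (x + (0, 1))) := by
  have key : ∀ e : Torus L, ∑ y : Torus L, (if x - y = e then (1 : ℝ) else 0) * spin (σ y)
      = spin (σ (x - e)) := by
    intro e
    have : ∀ y : Torus L, (x - y = e) ↔ (y = x - e) := fun y => by
      constructor
      · rintro rfl; abel
      · rintro rfl; abel
    simp [this]
  have h1 : x - ((-1, 0) : Torus L) = x + (1, 0) := by ext <;> simp
  have h2 : x - ((0, -1) : Torus L) = x + (0, 1) := by ext <;> simp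
  simp only [localField, kernel_eq hL, add_mul, Finset.sum_add_distrib, key, h1, h2]

lemma exp_neg_hamiltonian {β : ℝ} (hβ : β ≠ 0) (h : ℝ) (σ : Config L) :
    Real.exp (-β * hamiltonian β h σ) = Real.exp (β * (h * ∑ x, spin (σ x))) *
      ∏ x, Real.cosh (β * (localField σ x + h)) := by
  have h1 : -β * hamiltonian β h σ = β * (h * ∑ x, spin (σ x)) +
      ∑ x, Real.log (Real.cosh (β * (localField σ x + h))) := by
    unfold hamiltonian; field_simp; ring
  rw [h1, Real.exp_add, Real.exp_sum]
  congr 1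
  exact Finset.prod_congr rfl fun x _ => Real.exp_log (Real.cosh_pos _)

/-- In this form the denominators cancel the `cosh` product in `exp_neg_hamiltonian`. -/
lemma siteProb_eq (β h : ℝ) (σ : Config L) (x : Torus L) (s : ℤˣ) : siteProb β h σ x s =
    Real.exp (β * (spin s * (localField σ x + h))) /
      (2 * Real.cosh (β * (localField σ x + h))) := by
  have key : ∀ y : ℝ, 1 / (1 + Real.exp (-2 * y)) = Real.exp y / (Real.exp y + Real.exp (-y)) := by
    intro y
    have h1 : Real.exp (-2 * y) = Real.exp (-y) * Real.exp (-y) := by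
      rw [← Real.exp_add]; congr 1; ring
    have h2 : Real.exp y * Real.exp (-y) = 1 := by rw [← Real.exp_add]; simp
    rw [div_eq_div_iff (by positivity) (by positivity), h1]
    linear_combination (-Real.exp (-y)) * h2
  unfold siteProb
  rw [Real.cosh_eq]
  rcases Int.units_eq_one_or s with rfl | rfl
  · have := key (β * (localField σ x + h))
    rw [spin_one]
    calc _ = 1 / (1 + Real.exp (-2 * (β * (localField σ x + h)))) := by ring_nf
      _ = _ := by rw [this]; ring_nf
  · have := key (-(β * (localField σ x + h)))
    rw [spin_neg_one]
    calc _ = 1 / (1 + Real.exp (-2 * -(β * (localField σ x + h)))) := by ring_nf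
      _ = _ := by rw [this, neg_neg]; ring_nf

lemma sum_spin_mul_right (σ : Config L) : ∑ x : Torus L, spin (σ x) * spin (σ (x + (1, 0)))
    = (L : ℝ) ^ 2 - 2 * ((∑ r, cyc (row (plusSet σ) r) : ℕ) : ℝ) := by
  have h1 : ∀ x : Torus L, spin (σ x) * spin (σ (x + (1, 0))) =
      1 - 2 * (if ¬ (σ x = 1 ↔ σ (x + (1, 0)) = 1) then (1 : ℝ) else 0) := by
    intro x
    rcases Int.units_eq_one_or (σ x) with a | a <;>
      rcases Int.units_eq_one_or (σ (x + (1, 0))) with b | b <;>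
      simp [a, b] <;> norm_num
  have h2 : ∀ r, (cyc (row (plusSet σ) r) : ℝ) =
      ∑ x : ZMod L, if ¬ (σ (x, r) = 1 ↔ σ ((x, r) + (1, 0)) = 1) then (1 : ℝ) else 0 := by
    intro r
    simp [cyc, Finset.card_filter]
  simp only [h1, Finset.sum_sub_distrib, ← Finset.mul_sum, Fintype.sum_prod_type_right]
  push_cast
  simp only [h2]
  simp [ZMod.card, sq]

lemma sum_spin_mul_up (σ : Config L) : ∑ x : Torus L, spin (σ x) * spin (σ (x + (0, 1)))
    = (L : ℝ) ^ 2 - 2 * ((∑ c, cyc (col (plusSet σ) c) : ℕ) : ℝ) := by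
  have h1 : ∀ x : Torus L, spin (σ x) * spin (σ (x + (0, 1))) =
      1 - 2 * (if ¬ (σ x = 1 ↔ σ (x + (0, 1)) = 1) then (1 : ℝ) else 0) := by
    intro x
    rcases Int.units_eq_one_or (σ x) with a | a <;>
      rcases Int.units_eq_one_or (σ (x + (0, 1))) with b | b <;>
      simp [a, b] <;> norm_num
  have h2 : ∀ c, (cyc (col (plusSet σ) c) : ℝ) =
      ∑ y : ZMod L, if ¬ (σ (c, y) = 1 ↔ σ ((c, y) + (0, 1)) = 1) then (1 : ℝ) else 0 := by
    intro r
    simp [cyc, Finset.card_filter]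
  simp only [h1, Finset.sum_sub_distrib, ← Finset.mul_sum, Fintype.sum_prod_type]
  push_cast
  simp only [h2]
  simp [ZMod.card, sq]

lemma sum_spin (σ : Config L) : ∑ x, spin (σ x) = 2 * ((plusSet σ).card : ℝ) - (L : ℝ) ^ 2 := by
  have h1 : ∀ x : Torus L, spin (σ x) = 2 * (if σ x = 1 then (1 : ℝ) else 0) - 1 := by
    intro x
    rcases Int.units_eq_one_or (σ x) with a | a <;> simp [a]
    norm_num
  have h2 : ((plusSet σ).card : ℝ) = ∑ x, if σ x = 1 then (1 : ℝ) else 0 := by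
    simp [plusSet]
  simp only [h1, Finset.sum_sub_distrib, ← Finset.mul_sum, h2]
  simp [Fintype.card_prod, ZMod.card, sq]

/-- The ends of a bond have opposite parities, so a spin of η at one end and a spin of σ at the
other belong to the same copy. -/
lemma mix_bond {e : Torus L} (he : ∀ x : Torus L, EvenSite (x + e) ↔ ¬ EvenSite x)
    (σ η : Config L) (x : Torus L) :
    spin (η x) * spin (σ (x + e)) + spin (η (x + e)) * spin (σ x) =
      spin (mix σ η x) * spin (mix σ η (x + e)) + spin (mix η σ x) * spin (mix η σ (x + e)) := by
  by_cases h : EvenSite x <;> simp [mix, he, h] <;> ring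

lemma sum_bond {e : Torus L} (he : ∀ x : Torus L, EvenSite (x + e) ↔ ¬ EvenSite x)
    (σ η : Config L) :
    ∑ x, spin (η x) * (spin (σ (x - e)) + spin (σ (x + e))) =
      ∑ x, spin (mix σ η x) * spin (mix σ η (x + e)) +
        ∑ x, spin (mix η σ x) * spin (mix η σ (x + e)) := by
  have h1 : ∑ x, spin (η x) * spin (σ (x - e)) = ∑ x, spin (η (x + e)) * spin (σ x) := by
    rw [← Equiv.sum_comp (Equiv.addRight e)]
    simp
  simp only [mul_add, Finset.sum_add_distrib]
  rw [h1, add_comm, ← Finset.sum_add_distrib, ← Finset.sum_add_distrib]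
  exact Finset.sum_congr rfl fun x _ => mix_bond he σ η x

/-- The interaction energy of a transition is that of the two mixed Ising configurations. -/
lemma sum_energy (hL : 2 < L) (hLe : Even L) (h : ℝ) (σ η : Config L) :
    h * ∑ x, spin (σ x) + ∑ x, spin (η x) * (localField σ x + h) =
      (4 - 2 * h) * (L : ℝ) ^ 2 - pairEnergy h σ η := by
  have hr : ∀ x : Torus L, EvenSite (x + (1, 0)) ↔ ¬ EvenSite x := fun x => by
    have := evenSite_right hLe x.1 x.2
    rwa [← show x + (1, 0) = (x.1 + 1, x.2) by ext <;> simp] at this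
  have hu : ∀ x : Torus L, EvenSite (x + (0, 1)) ↔ ¬ EvenSite x := fun x => by
    have := evenSite_up hLe x.1 x.2
    rwa [← show x + (0, 1) = (x.1, x.2 + 1) by ext <;> simp] at this
  have h1 : ∑ x, spin (η x) * (localField σ x + h) =
      ∑ x, spin (η x) * (spin (σ (x - (1, 0))) + spin (σ (x + (1, 0)))) +
      ∑ x, spin (η x) * (spin (σ (x - (0, 1))) + spin (σ (x + (0, 1)))) +
      h * ∑ x, spin (η x) := by
    rw [Finset.mul_sum, ← Finset.sum_add_distrib, ← Finset.sum_add_distrib]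
    refine Finset.sum_congr rfl fun x _ => ?_
    rw [localField_eq hL]; ring
  have h2 : ∑ x, spin (σ x) + ∑ x, spin (η x) =
      ∑ x, spin (mix σ η x) + ∑ x, spin (mix η σ x) := by
    rw [← Finset.sum_add_distrib, ← Finset.sum_add_distrib]
    refine Finset.sum_congr rfl fun x _ => ?_
    by_cases hx : EvenSite x <;> simp [mix, hx, add_comm]
  rw [h1, sum_bond hr, sum_bond hu]
  rw [sum_spin (mix σ η), sum_spin (mix η σ)] at h2
  simp only [sum_spin_mul_right, sum_spin_mul_up]
  simp only [pairEnergy, excess, perimeter]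
  push_cast
  -- The constant collects the 2L² bonds and the field term -hL² of each copy.
  linear_combination h * h2

/-- The common prefactor of the weights of all transitions. -/
def weightConst (L : ℕ) [NeZero L] (β h : ℝ) : ℝ :=
  Real.exp (β * ((4 - 2 * h) * (L : ℝ) ^ 2)) /
    (2 ^ Fintype.card (Torus L) * partitionFun L β h)

lemma partitionFun_pos (L : ℕ) [NeZero L] (β h : ℝ) : 0 < partitionFun L β h :=
  Finset.sum_pos (fun _ _ => Real.exp_pos _) Finset.univ_nonempty

lemma weightConst_pos (L : ℕ) [NeZero L] (β h : ℝ) : 0 < weightConst L β h :=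
  div_pos (Real.exp_pos _) (mul_pos (by positivity) (partitionFun_pos L β h))

lemma gibbs_mul_transProb (hL : 2 < L) (hLe : Even L) {β : ℝ} (hβ : β ≠ 0) (h : ℝ)
    (σ η : Config L) : gibbs β h σ * transProb β h σ η =
      weightConst L β h * Real.exp (-β * pairEnergy h σ η) := by
  have hcosh : (∏ x, Real.cosh (β * (localField σ x + h))) ≠ 0 :=
    Finset.prod_ne_zero_iff.2 fun x _ => (Real.cosh_pos _).ne'
  have hZ := (partitionFun_pos L β h).ne'
  have h1 : transProb β h σ η = Real.exp (β * ∑ x, spin (η x) * (localField σ x + h)) /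
      (2 ^ Fintype.card (Torus L) * ∏ x, Real.cosh (β * (localField σ x + h))) := by
    unfold transProb
    simp only [siteProb_eq, Finset.prod_div_distrib, ← Real.exp_sum, Finset.prod_mul_distrib,
      Finset.prod_const, Finset.mul_sum, Finset.card_univ]
  have h2 : Real.exp (β * ((4 - 2 * h) * (L : ℝ) ^ 2)) * Real.exp (-β * pairEnergy h σ η) =
      Real.exp (β * (h * ∑ x, spin (σ x))) *
        Real.exp (β * ∑ x, spin (η x) * (localField σ x + h)) := by
    rw [← Real.exp_add, ← Real.exp_add]
    congr 1
    linear_combination (-β) * sum_energy hL hLe h σ η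
  rw [gibbs, exp_neg_hamiltonian hβ, h1, weightConst, div_mul_eq_mul_div _ _ (Real.exp _), h2]
  field_simp

/-- The level `G` is free; it will be the barrier, at which `netCap` converges. -/
lemma capacity_eq (hL : 2 < L) (hLe : Even L) {β : ℝ} (hβ : β ≠ 0) (h G : ℝ)
    (A B : Finset (Config L)) : capacity β h A B =
      weightConst L β h * Real.exp (-β * G) * netCap (pairEnergy h) G A B β := by
  have h1 : dirichlet β h = fun f : Config L → ℝ =>
      (weightConst L β h * Real.exp (-β * G)) • netForm (pairEnergy h) G β f := by
    funext f
    simp only [dirichlet, netForm, smul_eq_mul, Finset.mul_sum]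
    refine Finset.sum_congr rfl fun σ _ => Finset.sum_congr rfl fun η _ => ?_
    rw [gibbs_mul_transProb hL hLe hβ]
    have : Real.exp (-β * pairEnergy h σ η) =
        Real.exp (-β * G) * Real.exp (-β * (pairEnergy h σ η - G)) := by
      rw [← Real.exp_add]; congr 1; ring
    rw [this]; ring
  have hc : 0 ≤ weightConst L β h * Real.exp (-β * G) :=
    (mul_pos (weightConst_pos L β h) (Real.exp_pos _)).le
  unfold capacity netCap
  rw [h1, ← smul_eq_mul (a := weightConst L β h * _), ← Real.sInf_smul_of_nonneg hc,
    ← Set.image_smul, Set.image_image]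
  rfl

/-- Four unanimous neighbours give a field of modulus at least 4 - h in the direction of η, so every
update follows it with probability tending to 1. -/
lemma tendsto_transProb (hL : 2 < L) {h : ℝ} (h_pos : 0 < h) (h_lt : h < 1) {σ η : Config L}
    (hσ : ∀ x : Torus L, σ (x - (1, 0)) = η x ∧ σ (x + (1, 0)) = η x ∧ σ (x - (0, 1)) = η x ∧
      σ (x + (0, 1)) = η x) :
    Filter.Tendsto (fun β => transProb β h σ η) Filter.atTop (nhds 1) := by
  have key : ∀ x, Filter.Tendsto (fun β => siteProb β h σ x (η x)) Filter.atTop (nhds 1) := by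
    intro x
    obtain ⟨h1, h2, h3, h4⟩ := hσ x
    have hpos : 0 < 2 * (spin (η x) * (localField σ x + h)) := by
      rw [localField_eq hL, h1, h2, h3, h4]
      rcases Int.units_eq_one_or (η x) with a | a <;> simp only [a, spin_one, spin_neg_one] <;>
        linarith
    have h5 := tendsto_exp_neg_mul hpos
    have h6 : ∀ β : ℝ, siteProb β h σ x (η x) =
        1 / (1 + Real.exp (-β * (2 * (spin (η x) * (localField σ x + h))))) := fun β => by
      unfold siteProb; congr 3; ring
    simp only [h6]
    have h7 := (tendsto_const_nhds (x := (1 : ℝ))).div (h5.const_add 1) (by norm_num)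
    rw [add_zero, div_one] at h7
    exact h7
  have := tendsto_finsetProd (Finset.univ : Finset (Torus L)) fun x _ => key x
  simpa [transProb] using this

end Mixing

/-! ### The optimal cut -/

section Cut

variable {L : ℕ} [NeZero L]

/-- Classes `Ok` of admissible sets, containing all sets below the critical energy, inside which
the subcritical sets cannot be left by adding one site. -/
structure Confining (h : ℝ) (m : ℕ) (Ok : Finset (Torus L) → Prop) : Prop where
  of_lt : ∀ s, excess h s < critEnergy h m → Ok s
  le : ∀ s, Ok s → excess h s ≤ critEnergy h m
  step : ∀ s z, z ∉ s → Subcritical m s → Ok s → Ok (insert z s) → Subcritical m (insert z s)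

/-- The strict sublevel set works even if hm = 2, which suffices for the existence of the limit. -/
lemma confining_lt {m : ℕ} (hm : 2 ≤ m) (hL : 2 * (m + 1) < L) {h : ℝ} (h_pos : 0 < h)
    (hh : h * m ≤ 2) :
    Confining h m fun s : Finset (Torus L) => excess h s < critEnergy h m where
  of_lt _ hs := hs
  le _ hs := hs.le
  step s z hz hs hE hE' := by
    rcases subcritical_insert hm hL h_pos hh hs hz hE.le hE'.le with h1 | h1 | h1
    · exact h1
    · exact absurd (excess_of_mem_critSet hm hL h h1) hE'.ne
    · exact absurd h1.1 hE'.ne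

/-- If hm < 2, every set at the critical energy other than a droplet can be admitted; the critical
edges of the cut then come only from droplets. -/
lemma confining_notMem {m : ℕ} (hm : 2 ≤ m) (hL : 2 * (m + 1) < L) {h : ℝ} (h_pos : 0 < h)
    (hh : h * m < 2) :
    Confining h m fun s : Finset (Torus L) => excess h s ≤ critEnergy h m ∧ s ∉ critSet L m where
  of_lt _ hs := ⟨hs.le, fun hmem => hs.ne (excess_of_mem_critSet hm hL h hmem)⟩
  le _ hs := hs.1
  step s z hz hs hE hE' := by
    rcases subcritical_insert hm hL h_pos hh.le hs hz hE.1 hE'.1 with h1 | h1 | h1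
    · exact h1
    · exact absurd h1 hE'.2
    · exact absurd h1.2 hh.ne

/-- The even half of `σ` is that of an admissible subcritical set. -/
def SubEven (m : ℕ) (Ok : Finset (Torus L) → Prop) (σ : Config L) : Prop :=
  ∃ s, Subcritical m s ∧ Ok s ∧ ∀ x, EvenSite x → (x ∈ s ↔ σ x = 1)

/-- The odd half of `σ` is that of an admissible subcritical set. -/
def SubOdd (m : ℕ) (Ok : Finset (Torus L) → Prop) (σ : Config L) : Prop :=
  ∃ s, Subcritical m s ∧ Ok s ∧ ∀ x, ¬ EvenSite x → (x ∈ s ↔ σ x = 1)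

variable {m : ℕ} {h : ℝ} {Ok : Finset (Torus L) → Prop}

/-- Being subcritical depends only on the even half: by `class_stable` the witness may be replaced
by any admissible set with that half. -/
lemma subcritical_of_subEven (hL : 1 < L) (hLe : Even L) (h_pos : 0 < h) (h_lt : h < 1)
    (hOk : Confining h m Ok) {σ : Config L} (hσ : SubEven m Ok σ) {t : Finset (Torus L)}
    (ht : Ok t) (hag : ∀ x, EvenSite x → (x ∈ t ↔ σ x = 1)) : Subcritical m t := by
  obtain ⟨s, hs, hos, hsσ⟩ := hσ
  refine class_stable hL h_pos h_lt (Q := EvenSite) ?_ hOk.of_lt hOk.le hOk.step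
    (fun s z _ hs => hs.mono (Finset.subset_insert _ _)) _ s t rfl
    (fun w hw => (hsσ w hw).trans (hag w hw).symm) hs hos ht
  rintro ⟨x, y⟩ hz
  exact ⟨(evenSite_up hLe x y).2 hz, (evenSite_down hLe x y).2 hz, (evenSite_right hLe x y).2 hz,
    (evenSite_left hLe x y).2 hz⟩

lemma subcritical_of_subOdd (hL : 1 < L) (hLe : Even L) (h_pos : 0 < h) (h_lt : h < 1)
    (hOk : Confining h m Ok) {σ : Config L} (hσ : SubOdd m Ok σ) {t : Finset (Torus L)}
    (ht : Ok t) (hag : ∀ x, ¬ EvenSite x → (x ∈ t ↔ σ x = 1)) : Subcritical m t := by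
  obtain ⟨s, hs, hos, hsσ⟩ := hσ
  refine class_stable hL h_pos h_lt (Q := fun x => ¬ EvenSite x) ?_ hOk.of_lt hOk.le hOk.step
    (fun s z _ hs => hs.mono (Finset.subset_insert _ _)) _ s t rfl
    (fun w hw => (hsσ w hw).trans (hag w hw).symm) hs hos ht
  rintro ⟨x, y⟩ hz
  rw [not_not] at hz
  simp only [evenSite_up hLe, evenSite_down hLe, evenSite_right hLe, evenSite_left hLe, hz,
    not_true_eq_false, not_false_eq_true, and_self]

lemma mem_plusSet_mix_even (σ η : Config L) {x : Torus L} (hx : EvenSite x) :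
    x ∈ plusSet (mix σ η) ↔ σ x = 1 := by simp [mix, hx]

lemma mem_plusSet_mix_odd (σ η : Config L) {x : Torus L} (hx : ¬ EvenSite x) :
    x ∈ plusSet (mix σ η) ↔ η x = 1 := by simp [mix, hx]

/-- An admissible transition does not change the subcritical nature of a copy. -/
lemma subEven_iff_subOdd (hL : 1 < L) (hLe : Even L) (h_pos : 0 < h) (h_lt : h < 1)
    (hOk : Confining h m Ok) {σ η : Config L} (ht : Ok (plusSet (mix σ η))) :
    SubEven m Ok σ ↔ SubOdd m Ok η := by
  constructor
  · intro hσ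
    exact ⟨_, subcritical_of_subEven hL hLe h_pos h_lt hOk hσ ht
      fun x hx => mem_plusSet_mix_even σ η hx, ht, fun x hx => mem_plusSet_mix_odd σ η hx⟩
  · intro hη
    exact ⟨_, subcritical_of_subOdd hL hLe h_pos h_lt hOk hη ht
      fun x hx => mem_plusSet_mix_odd σ η hx, ht, fun x hx => mem_plusSet_mix_even σ η hx⟩

/-- A copy that is subcritical at one end of a transition has nonnegative energy. -/
lemma excess_mix_nonneg (hm : 2 ≤ m) (hL : 2 * (m + 1) < L) (hLe : Even L) (h_pos : 0 < h)
    (h_lt : h < 1) (hh : h * m ≤ 2) (hOk : Confining h m Ok) {σ η : Config L}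
    (hs : SubEven m Ok σ ∨ SubOdd m Ok η) :
    0 ≤ excess h (plusSet (mix σ η)) ∧
      (excess h (plusSet (mix σ η)) = 0 → plusSet (mix σ η) = ∅) := by
  by_cases ht : Ok (plusSet (mix σ η))
  · have hsub : Subcritical m (plusSet (mix σ η)) := by
      rcases hs with hs | hs
      · exact subcritical_of_subEven (by omega) hLe h_pos h_lt hOk hs ht
          fun x hx => mem_plusSet_mix_even σ η hx
      · exact subcritical_of_subOdd (by omega) hLe h_pos h_lt hOk hs ht
          fun x hx => mem_plusSet_mix_odd σ η hx
    rcases (plusSet (mix σ η)).eq_empty_or_nonempty with he | hne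
    · rw [he]; simp
    · have := hsub.excess_pos hm hL h_pos h_lt hh hne
      exact ⟨this.le, fun h0 => absurd h0 this.ne'⟩
  · have h1 : critEnergy h m ≤ excess h (plusSet (mix σ η)) := by
      by_contra! hlt
      exact ht (hOk.of_lt _ hlt)
    have h2 := critEnergy_pos h_pos h_lt hh
    exact ⟨by linarith, fun h0 => by linarith⟩

/-! ### Position of the reference configurations relative to the cuts -/

lemma subcritical_empty : Subcritical m (∅ : Finset (Torus L)) := Or.inl (by simp)

lemma ok_empty (h_pos : 0 < h) (h_lt : h < 1) (hh : h * m ≤ 2) (hOk : Confining h m Ok) :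
    Ok ∅ := hOk.of_lt _ (by rw [excess_empty]; exact critEnergy_pos h_pos h_lt hh)

lemma excess_univ_neg (h_pos : 0 < h) : excess h (Finset.univ : Finset (Torus L)) < 0 := by
  have : 0 < (L : ℝ) := Nat.cast_pos.2 (Nat.pos_of_ne_zero (NeZero.ne L))
  rw [excess_univ]
  nlinarith [mul_pos h_pos (pow_pos this 2)]

lemma ok_univ (h_pos : 0 < h) (h_lt : h < 1) (hh : h * m ≤ 2) (hOk : Confining h m Ok) :
    Ok Finset.univ :=
  hOk.of_lt _ ((excess_univ_neg h_pos).trans (critEnergy_pos h_pos h_lt hh))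

lemma not_subcritical_univ (hL : 2 * (m + 1) < L) :
    ¬ Subcritical m (Finset.univ : Finset (Torus L)) := fun hs => by
  have := hs.card_le
  simp only [Finset.card_univ, Fintype.card_prod, ZMod.card] at this
  nlinarith

lemma subEven_of_minus (h_pos : 0 < h) (h_lt : h < 1) (hh : h * m ≤ 2) (hOk : Confining h m Ok)
    {σ : Config L} (hσ : ∀ x, EvenSite x → σ x = -1) : SubEven m Ok σ :=
  ⟨∅, subcritical_empty, ok_empty h_pos h_lt hh hOk, fun x hx => by simp [hσ x hx]⟩

lemma subOdd_of_minus (h_pos : 0 < h) (h_lt : h < 1) (hh : h * m ≤ 2) (hOk : Confining h m Ok)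
    {σ : Config L} (hσ : ∀ x, ¬ EvenSite x → σ x = -1) : SubOdd m Ok σ :=
  ⟨∅, subcritical_empty, ok_empty h_pos h_lt hh hOk, fun x hx => by simp [hσ x hx]⟩

lemma not_subEven_of_plus (hL : 2 * (m + 1) < L) (hLe : Even L) (h_pos : 0 < h) (h_lt : h < 1)
    (hh : h * m ≤ 2) (hOk : Confining h m Ok) {σ : Config L} (hσ : ∀ x, EvenSite x → σ x = 1) :
    ¬ SubEven m Ok σ := fun hs =>
  not_subcritical_univ hL (subcritical_of_subEven (by omega) hLe h_pos h_lt hOk hs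
    (ok_univ h_pos h_lt hh hOk) fun x hx => by simp [hσ x hx])

lemma not_subOdd_of_plus (hL : 2 * (m + 1) < L) (hLe : Even L) (h_pos : 0 < h) (h_lt : h < 1)
    (hh : h * m ≤ 2) (hOk : Confining h m Ok) {σ : Config L} (hσ : ∀ x, ¬ EvenSite x → σ x = 1) :
    ¬ SubOdd m Ok σ := fun hs =>
  not_subcritical_univ hL (subcritical_of_subOdd (by omega) hLe h_pos h_lt hOk hs
    (ok_univ h_pos h_lt hh hOk) fun x hx => by simp [hσ x hx])

/-- `f₀` is a potential whose jumps cost at least the critical energy above that of the spectator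
configuration `q`, with equality only for a nonadmissible copy of critical energy. -/
def IsCut (h : ℝ) (m : ℕ) (Ok : Finset (Torus L) → Prop) (q : Finset (Torus L))
    (f₀ : Config L → ℝ) : Prop :=
  ∀ σ η, f₀ σ ≠ f₀ η → critEnergy h m + excess h q ≤ pairEnergy h σ η ∧
    (pairEnergy h σ η = critEnergy h m + excess h q →
      (¬ Ok (plusSet (mix σ η)) ∧ excess h (plusSet (mix σ η)) = critEnergy h m ∧
        plusSet (mix η σ) = q) ∨
      (¬ Ok (plusSet (mix η σ)) ∧ excess h (plusSet (mix η σ)) = critEnergy h m ∧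
        plusSet (mix σ η) = q))

lemma isCut_indicator {q : Finset (Torus L)} {P : Config L → Prop} [DecidablePred P]
    (H : ∀ σ η, P σ → ¬ P η → critEnergy h m + excess h q ≤ pairEnergy h σ η ∧
    (pairEnergy h σ η = critEnergy h m + excess h q →
      (¬ Ok (plusSet (mix σ η)) ∧ excess h (plusSet (mix σ η)) = critEnergy h m ∧
        plusSet (mix η σ) = q) ∨
      (¬ Ok (plusSet (mix η σ)) ∧ excess h (plusSet (mix η σ)) = critEnergy h m ∧
        plusSet (mix σ η) = q))) :
    IsCut h m Ok q fun σ => if P σ then 1 else 0 := by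
  intro σ η hne
  by_cases h1 : P σ <;> by_cases h2 : P η
  · simp [h1, h2] at hne
  · exact H σ η h1 h2
  · have := H η σ h2 h1
    rw [pairEnergy_comm] at this
    exact ⟨this.1, fun he => (this.2 he).symm⟩
  · simp [h1, h2] at hne

/-- The cut between `d` and `{c, u}`. -/
lemma exists_cut_minus (hm : 2 ≤ m) (hL : 2 * (m + 1) < L) (hLe : Even L) (h_pos : 0 < h)
    (h_lt : h < 1) (hh : h * m ≤ 2) (hOk : Confining h m Ok) :
    ∃ f₀ ∈ potentials {allMinus L} (checkersPlus L), IsCut h m Ok ∅ f₀ := by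
  classical
  have hL1 : 1 < L := by omega
  refine ⟨fun σ => if SubEven m Ok σ ∧ SubOdd m Ok σ then 1 else 0, ⟨fun σ => ?_, ?_, ?_⟩, ?_⟩
  · dsimp only; split_ifs <;> simp
  · intro σ hσ
    rw [Finset.mem_singleton.1 hσ]
    refine if_pos ?_
    exact ⟨subEven_of_minus h_pos h_lt hh hOk fun _ _ => rfl,
      subOdd_of_minus h_pos h_lt hh hOk fun _ _ => rfl⟩
  · intro σ hσ
    refine if_neg ?_
    simp only [checkersPlus, Finset.mem_insert, Finset.mem_singleton] at hσ
    rcases hσ with rfl | rfl | rfl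
    · rw [checkerEven_eq]
      exact fun hs => not_subEven_of_plus hL hLe h_pos h_lt hh hOk
        (fun x hx => by simp [mix, hx, allPlus]) hs.1
    · rw [checkerOdd_eq]
      exact fun hs => not_subOdd_of_plus hL hLe h_pos h_lt hh hOk
        (fun x hx => by simp [mix, hx, allPlus]) hs.2
    · exact fun hs => not_subEven_of_plus hL hLe h_pos h_lt hh hOk (fun _ _ => rfl) hs.1
  · refine isCut_indicator fun σ η hσ hη => ?_
    have n1 := excess_mix_nonneg hm hL hLe h_pos h_lt hh hOk (σ := σ) (η := η) (Or.inl hσ.1)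
    have n2 := excess_mix_nonneg hm hL hLe h_pos h_lt hh hOk (σ := η) (η := σ) (Or.inr hσ.2)
    have i1 := fun ht => subEven_iff_subOdd hL1 hLe h_pos h_lt hOk (σ := σ) (η := η) ht
    have i2 := fun ht => subEven_iff_subOdd hL1 hLe h_pos h_lt hOk (σ := η) (η := σ) ht
    -- Two admissible copies would carry both subcritical halves from σ to η. So one copy is at the
    -- critical energy or above, and the other, subcritical at σ, costs at least 0.
    have hcase : ¬ Ok (plusSet (mix σ η)) ∨ ¬ Ok (plusSet (mix η σ)) := by
      by_contra! hc
      exact hη ⟨(i2 hc.2).2 hσ.2, (i1 hc.1).1 hσ.1⟩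
    rw [excess_empty, add_zero]
    unfold pairEnergy
    rcases hcase with hc | hc
    · have h1 := not_lt.1 fun hlt => hc (hOk.of_lt _ hlt)
      exact ⟨by linarith, fun he => Or.inl ⟨hc, by linarith, n2.2 (by linarith)⟩⟩
    · have h1 := not_lt.1 fun hlt => hc (hOk.of_lt _ hlt)
      exact ⟨by linarith, fun he => Or.inr ⟨hc, by linarith, n1.2 (by linarith)⟩⟩

/-- The cut between `c` and `u`. -/
lemma exists_cut_plus (hL : 2 * (m + 1) < L) (hLe : Even L) (h_pos : 0 < h)
    (h_lt : h < 1) (hh : h * m ≤ 2) (hOk : Confining h m Ok) :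
    ∃ f₀ ∈ potentials (checkers L) {allPlus L}, IsCut h m Ok Finset.univ f₀ := by
  classical
  have hL1 : 1 < L := by omega
  refine ⟨fun σ => if SubEven m Ok σ ∨ SubOdd m Ok σ then 1 else 0, ⟨fun σ => ?_, ?_, ?_⟩, ?_⟩
  · dsimp only; split_ifs <;> simp
  · intro σ hσ
    refine if_pos ?_
    simp only [checkers, Finset.mem_insert, Finset.mem_singleton] at hσ
    rcases hσ with rfl | rfl
    · rw [checkerEven_eq]
      exact Or.inr (subOdd_of_minus h_pos h_lt hh hOk fun x hx => by simp [mix, hx, allMinus])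
    · rw [checkerOdd_eq]
      exact Or.inl (subEven_of_minus h_pos h_lt hh hOk fun x hx => by simp [mix, hx, allMinus])
  · intro σ hσ
    rw [Finset.mem_singleton.1 hσ]
    refine if_neg ?_
    rintro (hs | hs)
    · exact not_subEven_of_plus hL hLe h_pos h_lt hh hOk (fun _ _ => rfl) hs
    · exact not_subOdd_of_plus hL hLe h_pos h_lt hh hOk (fun _ _ => rfl) hs
  · refine isCut_indicator fun σ η hσ hη => ?_
    -- Here the spectator copy is bounded by the global minimum of the energy, so nothing need be
    -- known about its half.
    have n1 := excess_univ_le h_pos (plusSet (mix σ η))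
    have n2 := excess_univ_le h_pos (plusSet (mix η σ))
    have i1 := fun ht => subEven_iff_subOdd hL1 hLe h_pos h_lt hOk (σ := σ) (η := η) ht
    have i2 := fun ht => subEven_iff_subOdd hL1 hLe h_pos h_lt hOk (σ := η) (η := σ) ht
    have hcase : ¬ Ok (plusSet (mix σ η)) ∨ ¬ Ok (plusSet (mix η σ)) := by
      by_contra! hc
      rcases hσ with hσ | hσ
      · exact hη (Or.inr ((i1 hc.1).1 hσ))
      · exact hη (Or.inl ((i2 hc.2).2 hσ))
    unfold pairEnergy
    rcases hcase with hc | hc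
    · have h1 := not_lt.1 fun hlt => hc (hOk.of_lt _ hlt)
      exact ⟨by linarith, fun he =>
        Or.inl ⟨hc, by linarith, eq_univ_of_excess_le h_pos (by linarith)⟩⟩
    · have h1 := not_lt.1 fun hlt => hc (hOk.of_lt _ hlt)
      exact ⟨by linarith, fun he =>
        Or.inr ⟨hc, by linarith, eq_univ_of_excess_le h_pos (by linarith)⟩⟩

end Cut

/-! ### Clusters of the dynamics -/

section Clusters

variable {L : ℕ} [NeZero L]

/-- An added site is visible in only one of the two configurations of a transition; the other end of
the edge stays fixed. -/
lemma mix_conf_insert_even {s q : Finset (Torus L)} {z : Torus L} (hz : EvenSite z) :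
    mix (conf q) (conf (insert z s)) = mix (conf q) (conf s) := by
  funext x
  by_cases hx : EvenSite x
  · simp [mix, hx]
  · have : x ≠ z := fun h => hx (h ▸ hz)
    simp [mix, hx, conf, this]

lemma mix_conf_insert_odd {s q : Finset (Torus L)} {z : Torus L} (hz : ¬ EvenSite z) :
    mix (conf (insert z s)) (conf q) = mix (conf s) (conf q) := by
  funext x
  by_cases hx : EvenSite x
  · have : x ≠ z := fun h => hz (h ▸ hx)
    simp [mix, hx, conf, this]
  · simp [mix, hx]

/-- A growth of droplets with energies in `K` is followed by the dynamics of one copy, the other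
one staying in the configuration `q`. -/
lemma eqvGen_of_grow {h : ℝ} {K : Set ℝ} (q : Finset (Torus L)) {s t : Finset (Torus L)}
    (hst : Grow h K s t) (hs : excess h s ∈ K) :
    Relation.EqvGen (fun σ η => pairEnergy h σ η - excess h q ∈ K)
      (mix (conf s) (conf q)) (mix (conf t) (conf q)) ∧
    Relation.EqvGen (fun σ η => pairEnergy h σ η - excess h q ∈ K)
      (mix (conf t) (conf q)) (mix (conf q) (conf t)) := by
  have hedge : ∀ t, excess h t ∈ K →
      Relation.EqvGen (fun σ η => pairEnergy h σ η - excess h q ∈ K)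
        (mix (conf t) (conf q)) (mix (conf q) (conf t)) := fun t ht =>
    Relation.EqvGen.rel _ _ (by rwa [pairEnergy_mix, add_sub_cancel_right])
  induction hst with
  | refl => exact ⟨Relation.EqvGen.refl _, hedge _ hs⟩
  | tail _ hstep ih =>
    obtain ⟨hK, z, hz, rfl⟩ := hstep
    refine ⟨ih.1.trans _ _ _ ?_, hedge _ hK⟩
    -- For odd z the first configuration is unchanged; for even z the second one is, and the path
    -- crosses to it and back.
    by_cases hze : EvenSite z
    · have h1 := hedge _ hK
      rw [mix_conf_insert_even hze] at h1
      exact ih.2.trans _ _ _ (h1.symm _ _)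
    · rw [mix_conf_insert_odd hze]
      exact Relation.EqvGen.refl _

/-- The oriented transitions in which one copy is a critical droplet and the other one is `q`. -/
def critTransitions (m : ℕ) (q : Finset (Torus L)) : Finset (Config L × Config L) :=
  ((critSet L m).image fun s => (mix (conf s) (conf q), mix (conf q) (conf s))) ∪
    (critSet L m).image fun s => (mix (conf q) (conf s), mix (conf s) (conf q))

lemma mem_critTransitions {m : ℕ} {q : Finset (Torus L)} {σ η : Config L}
    (h1 : plusSet (mix σ η) ∈ critSet L m) (h2 : plusSet (mix η σ) = q) :
    (σ, η) ∈ critTransitions m q ∧ (η, σ) ∈ critTransitions m q := by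
  have e1 : mix (conf (plusSet (mix σ η))) (conf q) = σ := by rw [← h2]; simp
  have e2 : mix (conf q) (conf (plusSet (mix σ η))) = η := by rw [← h2]; simp
  constructor
  · exact Finset.mem_union_left _ (Finset.mem_image.2 ⟨_, h1, by rw [e1, e2]⟩)
  · exact Finset.mem_union_right _ (Finset.mem_image.2 ⟨_, h1, by rw [e1, e2]⟩)

lemma conf_injective : Function.Injective (conf (L := L)) :=
  Function.LeftInverse.injective plusSet_conf

/-- Each droplet gives two oriented edges; they could coincide only if the spectator were itself
critical. -/
lemma card_critTransitions {m : ℕ} {q : Finset (Torus L)} (hq : q ∉ critSet L m) :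
    (critTransitions m q).card = 2 * (critSet L m).card := by
  have hrec : ∀ {s s' : Finset (Torus L)}, mix (conf s) (conf q) = mix (conf s') (conf q) →
      mix (conf q) (conf s) = mix (conf q) (conf s') → s = s' := fun {s s'} h1 h2 => by
    have := mix_mix (conf s) (conf q)
    rw [h1, h2, mix_mix] at this
    exact (conf_injective this).symm
  rw [critTransitions, Finset.card_union_of_disjoint, Finset.card_image_of_injective,
    Finset.card_image_of_injective, two_mul]
  · exact fun s s' h => hrec (Prod.mk.inj h).2 (Prod.mk.inj h).1
  · exact fun s s' h => hrec (Prod.mk.inj h).1 (Prod.mk.inj h).2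
  · rw [Finset.disjoint_left]
    rintro p hp hp'
    obtain ⟨s, hs, rfl⟩ := Finset.mem_image.1 hp
    obtain ⟨s', hs', he⟩ := Finset.mem_image.1 hp'
    obtain ⟨h1, h2⟩ := Prod.mk.inj he
    have := mix_mix (conf s) (conf q)
    rw [← h1, ← h2, mix_mix] at this
    exact hq (conf_injective this ▸ hs)

/-- The rescaled capacity converges, to the number of critical droplets if `2 / h` is not an
integer. -/
theorem tendsto_netCap_pairEnergy {m : ℕ} (hm : 2 ≤ m) (hL : 2 * (m + 1) < L) (hLe : Even L)
    {h : ℝ} (h_pos : 0 < h) (h_lt : h < 1) (hh : h * m ≤ 2) (hh' : 2 < h * (m + 1))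
    {q : Finset (Torus L)} (hq : excess h q ≤ 0) {A B : Finset (Config L)}
    (ha : mix (conf ∅) (conf q) ∈ A) (hb : mix (conf Finset.univ) (conf q) ∈ B)
    (hcut : ∀ Ok, Confining h m Ok → ∃ f₀ ∈ potentials A B, IsCut h m Ok q f₀) :
    ∃ k : ℝ, 0 < k ∧
      Filter.Tendsto (netCap (pairEnergy h) (critEnergy h m + excess h q) A B) Filter.atTop
        (nhds k) ∧
      (h * m < 2 → k = 4 * ((m : ℝ) + 1) * (L : ℝ) ^ 2) := by
  have hpos := critEnergy_pos h_pos h_lt hh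
  obtain ⟨f₁, hf₁, hc₁⟩ := hcut _ (confining_lt hm hL h_pos hh)
  obtain ⟨k, hk, hlim⟩ := exists_tendsto_netCap (Γ := critEnergy h m + excess h q) hf₁
    (fun σ η hne => (hc₁ σ η hne).1) ha hb
    ((eqvGen_of_grow q (grow_univ hm hL h_pos h_lt hh hh') (by simpa using hpos.le)).1.mono
      fun σ η h1 => sub_le_iff_le_add.1 h1)
  refine ⟨k, hk, hlim, fun hlt => ?_⟩
  obtain ⟨f₂, hf₂, hc₂⟩ := hcut _ (confining_notMem hm hL h_pos hlt)
  have hmono : ∀ {x y : Config L}, Relation.EqvGen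
      (fun σ η => pairEnergy h σ η - excess h q ∈ Set.Iio (critEnergy h m)) x y →
      Relation.EqvGen (fun σ η => pairEnergy h σ η < critEnergy h m + excess h q) x y :=
    fun hxy => hxy.mono fun σ η h1 => sub_lt_iff_lt_add.1 h1
  have hcl : ∀ s ∈ critSet L m,
      (Relation.EqvGen (fun σ η => pairEnergy h σ η < critEnergy h m + excess h q)
          (mix (conf ∅) (conf q)) (mix (conf s) (conf q)) ∧
        Relation.EqvGen (fun σ η => pairEnergy h σ η < critEnergy h m + excess h q)
          (mix (conf Finset.univ) (conf q)) (mix (conf q) (conf s))) ∨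
      (Relation.EqvGen (fun σ η => pairEnergy h σ η < critEnergy h m + excess h q)
          (mix (conf ∅) (conf q)) (mix (conf q) (conf s)) ∧
        Relation.EqvGen (fun σ η => pairEnergy h σ η < critEnergy h m + excess h q)
          (mix (conf Finset.univ) (conf q)) (mix (conf s) (conf q))) := by
    intro s hs
    obtain ⟨R, z, y, hz, hsz, hy, hpar, hR, hE, hU⟩ :=
      critical_passage hm hL hLe h_pos h_lt hlt hh' hs
    obtain ⟨r1, r2⟩ := eqvGen_of_grow q hR (by simpa using hpos)
    obtain ⟨u1, -⟩ := eqvGen_of_grow q hU hE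
    obtain ⟨-, w2⟩ := eqvGen_of_grow q (K := Set.Iio (critEnergy h m)) (h := h)
      (Relation.ReflTransGen.refl (a := insert y s)) hE
    -- One end of the critical edge does not see z and lies in the cluster of `R`; the other does
    -- not see y, of the opposite parity, and already lies in the cluster of the full torus.
    by_cases hze : EvenSite z
    · right
      have hyo : ¬ EvenSite y := fun h1 => hpar.1 h1 hze
      rw [mix_conf_insert_odd hyo] at u1
      refine ⟨hmono ?_, hmono (u1.symm _ _)⟩
      rw [hsz, mix_conf_insert_even hze]
      exact r1.trans _ _ _ r2
    · left
      have hye : EvenSite y := hpar.2 hze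
      refine ⟨hmono ?_, hmono ?_⟩
      · rw [hsz, mix_conf_insert_odd hze]
        exact r1
      · rw [mix_conf_insert_even hye] at w2
        exact (u1.symm _ _).trans _ _ _ w2
  have hq' : q ∉ critSet L m := fun hmem => by
    have := excess_of_mem_critSet hm hL h hmem
    linarith
  have hlim' := tendsto_netCap (Γ := critEnergy h m + excess h q) hf₂
    (fun σ η hne => (hc₂ σ η hne).1) (critTransitions m q) ?_ ?_ ha hb ?_
  · rw [card_critTransitions hq', card_critSet hm hL] at hlim'
    rw [tendsto_nhds_unique hlim hlim']
    push_cast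
    ring
  · intro σ η hne hE
    rcases (hc₂ σ η hne).2 hE with ⟨g1, g2, g3⟩ | ⟨g1, g2, g3⟩
    · refine (mem_critTransitions ?_ g3).1
      by_contra hmem
      exact g1 ⟨g2.le, hmem⟩
    · refine (mem_critTransitions ?_ g3).2
      by_contra hmem
      exact g1 ⟨g2.le, hmem⟩
  · intro p hp
    rcases Finset.mem_union.1 hp with hp | hp <;> obtain ⟨s, hs, rfl⟩ := Finset.mem_image.1 hp
    · simp only [pairEnergy_mix, excess_of_mem_critSet hm hL h hs]
    · simp only [pairEnergy_comm h (mix (conf q) _), pairEnergy_mix,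
        excess_of_mem_critSet hm hL h hs]
  · intro p hp
    rcases Finset.mem_union.1 hp with hp | hp <;> obtain ⟨s, hs, rfl⟩ := Finset.mem_image.1 hp
    · exact hcl s hs
    · exact (hcl s hs).symm

end Clusters

/-! ### Sharp asymptotics -/

section Asymptotics

variable {L : ℕ} [NeZero L]

lemma activationEnergy_eq (h : ℝ) : activationEnergy h = critEnergy h ⌊2 / h⌋₊ := by
  unfold activationEnergy critEnergy critLength
  push_cast
  ring

lemma tendsto_transProb_allMinus (hL : 2 < L) {h : ℝ} (h_pos : 0 < h) (h_lt : h < 1) :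
    Filter.Tendsto (fun β => transProb β h (allMinus L) (allMinus L)) Filter.atTop (nhds 1) :=
  tendsto_transProb hL h_pos h_lt fun _ => ⟨rfl, rfl, rfl, rfl⟩

lemma tendsto_transProb_mix (hL : 2 < L) (hLe : Even L) {h : ℝ} (h_pos : 0 < h) (h_lt : h < 1)
    (a b : ℤˣ) :
    Filter.Tendsto (fun β => transProb β h (mix (fun _ => a) (fun _ => b))
      (mix (L := L) (fun _ => b) (fun _ => a))) Filter.atTop (nhds 1) := by
  have key : ∀ x y : Torus L, (EvenSite y ↔ ¬ EvenSite x) →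
      mix (fun _ => a) (fun _ => b) y = mix (L := L) (fun _ => b) (fun _ => a) x := by
    intro x y hxy
    by_cases hx : EvenSite x
    · simp [mix, hx, hxy.not.2 (not_not.2 hx)]
    · simp [mix, hx, hxy.2 hx]
  refine tendsto_transProb hL h_pos h_lt fun x => ⟨key _ _ ?_, key _ _ ?_, key _ _ ?_, key _ _ ?_⟩
  · have := evenSite_left hLe x.1 x.2
    rwa [← show x - (1, 0) = (x.1 - 1, x.2) by ext <;> simp] at this
  · have := evenSite_right hLe x.1 x.2
    rwa [← show x + (1, 0) = (x.1 + 1, x.2) by ext <;> simp] at this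
  · have := evenSite_down hLe x.1 x.2
    rwa [← show x - (0, 1) = (x.1, x.2 - 1) by ext <;> simp] at this
  · have := evenSite_up hLe x.1 x.2
    rwa [← show x + (0, 1) = (x.1, x.2 + 1) by ext <;> simp] at this

lemma transProb_pos (β h : ℝ) (σ η : Config L) : 0 < transProb β h σ η :=
  Finset.prod_pos fun x _ => by unfold siteProb; positivity

/-- Applied with η the likely successor of σ, this turns an edge weight into the asymptotics of
μ(σ). -/
lemma gibbs_eq_div (hL : 2 < L) (hLe : Even L) {β : ℝ} (hβ : β ≠ 0) (h : ℝ) (σ η : Config L) :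
    gibbs β h σ = weightConst L β h * Real.exp (-β * pairEnergy h σ η) / transProb β h σ η := by
  rw [← gibbs_mul_transProb hL hLe hβ, mul_div_cancel_right₀ _ (transProb_pos β h σ η).ne']

/-- From the limit of the rescaled capacity to the asymptotics of `μ(A) / cap(A, B)`, when the
mass of `A` is asymptotically `c` times the basic weight. -/
lemma isEquivalent_ratio (hL : 2 < L) (hLe : Even L) {h Γ X k c : ℝ} (hk : 0 < k) (hc : 0 < c)
    {A B : Finset (Config L)} {r μA : ℝ → ℝ}
    (hlim : Filter.Tendsto (netCap (pairEnergy h) (Γ + X) A B) Filter.atTop (nhds k))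
    (hr : Filter.Tendsto r Filter.atTop (nhds c))
    (hμ : ∀ β : ℝ, 0 < β → μA β = weightConst L β h * Real.exp (-β * X) * r β) :
    Asymptotics.IsEquivalent Filter.atTop (fun β => μA β / capacity β h A B)
      (fun β => Real.exp (β * Γ) / (k / c)) := by
  refine Asymptotics.isEquivalent_of_tendsto_one ?_
  have h1 : Filter.Tendsto (fun β => r β / netCap (pairEnergy h) (Γ + X) A B β * (k / c))
      Filter.atTop (nhds 1) := by
    have := (hr.div hlim hk.ne').mul_const (k / c)
    rwa [show c / k * (k / c) = 1 by field_simp] at this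
  refine h1.congr' ?_
  filter_upwards [Filter.eventually_gt_atTop 0, hlim.eventually (lt_mem_nhds hk)] with β hβ hpos
  have hw := (weightConst_pos L β h).ne'
  have he : Real.exp (-β * (Γ + X)) = Real.exp (-β * X) * (Real.exp (β * Γ))⁻¹ := by
    rw [← Real.exp_neg, ← Real.exp_add]; congr 1; ring
  simp only [Pi.div_apply]
  rw [hμ β hβ, capacity_eq hL hLe hβ.ne' h (Γ + X), he]
  have e1 := (Real.exp_pos (-β * X)).ne'
  have e2 := (Real.exp_pos (β * Γ)).ne'
  field_simp

end Asymptotics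

end PCA

end

open PCA in
theorem mainTheorem2 (L : ℕ) [NeZero L] (hL : Even L) (h : ℝ) (h_pos : 0 < h) (h_lt : h < 1)
    (hlarge : 2 * PCA.critLength h < L) :
    ∃ k₁ k₂ : ℝ, 0 < k₁ ∧ 0 < k₂ ∧
      Asymptotics.IsEquivalent Filter.atTop
        (fun β : ℝ => PCA.gibbs β h (PCA.allMinus L) /
          PCA.capacity β h {PCA.allMinus L} (PCA.checkersPlus L))
        (fun β : ℝ => Real.exp (β * PCA.activationEnergy h) / k₂) ∧
      Asymptotics.IsEquivalent Filter.atTop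
        (fun β : ℝ => PCA.gibbsSet β h (PCA.checkers L) /
          PCA.capacity β h (PCA.checkers L) {PCA.allPlus L})
        (fun β : ℝ => Real.exp (β * PCA.activationEnergy h) / k₁) ∧
      ((∀ n : ℕ, 2 / h ≠ (n : ℝ)) →
        k₂ = 4 * (PCA.critLength h : ℝ) * (L : ℝ) ^ 2 ∧
        k₁ = 2 * (PCA.critLength h : ℝ) * (L : ℝ) ^ 2) := by
  obtain ⟨m, hm⟩ : ∃ m, m = ⌊2 / h⌋₊ := ⟨_, rfl⟩
  have hlen : critLength h = m + 1 := by rw [hm]; rfl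
  have hdiv : 2 < 2 / h := by rw [lt_div_iff₀ h_pos]; linarith
  have hm2 : 2 ≤ m := by rw [hm]; exact Nat.le_floor (by exact_mod_cast hdiv.le)
  have hh : h * m ≤ 2 := by
    have := Nat.floor_le (show 0 ≤ 2 / h by positivity)
    rw [← hm, le_div_iff₀ h_pos] at this
    linarith
  have hh' : 2 < h * (m + 1) := by
    have := Nat.lt_floor_add_one (2 / h)
    rw [← hm, div_lt_iff₀ h_pos] at this
    linarith
  have hint : (∀ n : ℕ, 2 / h ≠ (n : ℝ)) → h * m < 2 := fun hn =>
    lt_of_le_of_ne hh fun he => hn m (by rw [← he]; field_simp)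
  rw [hlen] at hlarge
  have hL2 : 2 < L := by omega
  rw [activationEnergy_eq, ← hm, hlen]
  obtain ⟨k, hk, hlim, hval⟩ := tendsto_netCap_pairEnergy hm2 hlarge hL h_pos h_lt hh hh'
    (q := ∅) (A := {allMinus L}) (B := checkersPlus L) (by simp)
    (by simp [conf_empty, mix_self])
    (by simp [conf_empty, conf_univ, checkersPlus, checkerEven_eq])
    fun Ok hOk => exists_cut_minus hm2 hlarge hL h_pos h_lt hh hOk
  obtain ⟨k', hk', hlim', hval'⟩ := tendsto_netCap_pairEnergy hm2 hlarge hL h_pos h_lt hh hh'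
    (q := Finset.univ) (A := checkers L) (B := {allPlus L}) (excess_univ_neg h_pos).le
    (by simp [conf_empty, conf_univ, checkers, checkerOdd_eq])
    (by simp [conf_univ, mix_self])
    fun Ok hOk => exists_cut_plus hlarge hL h_pos h_lt hh hOk
  -- The divisors are the numbers of configurations in c and in {d}.
  refine ⟨k' / 2, k / 1, by positivity, by positivity, ?_, ?_, fun hn => ?_⟩
  · refine isEquivalent_ratio hL2 hL hk one_pos hlim
      (r := fun β => 1 / transProb β h (allMinus L) (allMinus L)) ?_ fun β hβ => ?_
    · simpa using (tendsto_transProb_allMinus hL2 h_pos h_lt).inv₀ one_ne_zero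
    · have h0 : pairEnergy h (allMinus L) (allMinus L) = excess h (∅ : Finset (Torus L)) := by
        simp [pairEnergy, mix_self, ← conf_empty]
      rw [gibbs_eq_div hL2 hL hβ.ne' h _ (allMinus L), h0]
      ring
  · refine isEquivalent_ratio hL2 hL hk' two_pos hlim'
      (r := fun β => 1 / transProb β h (checkerEven L) (checkerOdd L) +
        1 / transProb β h (checkerOdd L) (checkerEven L)) ?_ fun β hβ => ?_
    · have h1 := (tendsto_transProb_mix hL2 hL h_pos h_lt 1 (-1)).inv₀ one_ne_zero
      have h2 := (tendsto_transProb_mix hL2 hL h_pos h_lt (-1) 1).inv₀ one_ne_zero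
      have h3 := h1.add h2
      rw [inv_one, one_add_one_eq_two] at h3
      simp only [one_div, checkerEven_eq, checkerOdd_eq]
      exact h3
    · have h0 : pairEnergy h (checkerEven L) (checkerOdd L) =
          excess h (Finset.univ : Finset (Torus L)) := by
        rw [checkerEven_eq, checkerOdd_eq, ← conf_empty, ← conf_univ, pairEnergy_mix]
        simp
      have hne : checkerEven L ≠ checkerOdd L := fun he => by
        have := congrFun he 0
        simp [checkerEven, checkerOdd] at this
      have hsum : gibbsSet β h (checkers L) =
          gibbs β h (checkerEven L) + gibbs β h (checkerOdd L) := by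
        unfold gibbsSet checkers
        convert Finset.sum_pair hne
      rw [hsum, gibbs_eq_div hL2 hL hβ.ne' h _ (checkerOdd L),
        gibbs_eq_div hL2 hL hβ.ne' h (checkerOdd L) (checkerEven L),
        pairEnergy_comm h (checkerOdd L), h0]
      ring
  · rw [hval (hint hn), hval' (hint hn)]
    push_cast
    exact ⟨by ring, by ring⟩
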